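/- \textbf{Conventions.} Signatures are one-sorted first-order signatures with equality, and they share no symbol other than equality when called disjoint. An interpretation of a theory $T$ is a model of $T$ (with non-empty domain) together with values for the variables $x_0,x_1,\dots$. For theories $T_1$, $T_2$ over disjoint signatures $\Sigma_1$, $\Sigma_2$, $T_1\oplus T_2$ is the theory over $\Sigma_1\cup\Sigma_2$ axiomatized by $\mathrm{Ax}(T_1)\cup\mathrm{Ax}(T_2)$. An injective numbering of the function symbols and of the predicate symbols of $\Sigma_1\cup\Sigma_2$ by natural numbers is fixed; formulas over $\Sigma_1$, $\Sigma_2$ and $\Sigma_1\cup\Sigma_2$ are coded by natural numbers accordingly, and decidability of a set of formulas and computability of a function on formulas refer to these codes. A theory $T$ is \emph{decidable} if the set of quantifier-free formulas satisfied by some $T$-interpretation is decidable; \emph{infinitely decidable} if the set of quantifier-free formulas satisfied by some infinite $T$-interpretation is decidable; \emph{smooth} if, whenever a $T$-interpretation $\mathcal A$ satisfies a quantifier-free formula $\varphi$ and $\kappa>|\mathcal A|$ is a cardinal, some $T$-interpretation of cardinality $\kappa$ satisfies $\varphi$. A \emph{minimal model function} of $T$ is a function $\mathrm{minmod}$ from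 the quantifier-free formulas to $\mathbb N\cup\{\aleph_0\}$ such that for every $T$-satisfiable quantifier-free $\varphi$, some $T$-interpretation satisfying $\varphi$ has cardinality $\mathrm{minmod}(\varphi)$ and every $T$-interpretation satisfying $\varphi$ has cardinality at least $\mathrm{minmod}(\varphi)$. \textbf{Theorem.} Let $T_1$ and $T_2$ be decidable theories over disjoint signatures. Suppose that $T_1$ is smooth and has a computable minimal model function, and that $T_2$ is infinitely decidable. Then $T_1\oplus T_2$ is decidable. -/

import Mathlib

open FirstOrder Cardinal

universe u v u' v' u₁ v₁ u₂ v₂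

namespace TheoryCombination

/-- A numbering of the symbols of a signature: distinct function symbols receive distinct numbers,
and so do distinct predicate symbols. -/
structure Numbering (L : FirstOrder.Language.{u, v}) where
  func : (Σ n, L.Functions n) ↪ ℕ
  pred : (Σ n, L.Relations n) ↪ ℕ

/-- The numbering of the symbols of `L₁` that a numbering of `L₁ ∪ L₂` restricts to. -/
def Numbering.left {L₁ : FirstOrder.Language.{u, v}} {L₂ : FirstOrder.Language.{u', v'}}
    (c : Numbering (L₁.sum L₂)) : Numbering L₁ where
  func := ⟨fun f => c.func ⟨f.1, Sum.inl f.2⟩, fun f g h => by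
    obtain ⟨m, f⟩ := f
    obtain ⟨n, g⟩ := g
    have h' := c.func.injective h
    obtain ⟨rfl, h''⟩ := Sigma.mk.inj_iff.1 h'
    exact congrArg (Sigma.mk m) (Sum.inl_injective (eq_of_heq h''))⟩
  pred := ⟨fun r => c.pred ⟨r.1, Sum.inl r.2⟩, fun r s h => by
    obtain ⟨m, r⟩ := r
    obtain ⟨n, s⟩ := s
    have h' := c.pred.injective h
    obtain ⟨rfl, h''⟩ := Sigma.mk.inj_iff.1 h'
    exact congrArg (Sigma.mk m) (Sum.inl_injective (eq_of_heq h''))⟩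

/-- The numbering of the symbols of `L₂` that a numbering of `L₁ ∪ L₂` restricts to. -/
def Numbering.right {L₁ : FirstOrder.Language.{u, v}} {L₂ : FirstOrder.Language.{u', v'}}
    (c : Numbering (L₁.sum L₂)) : Numbering L₂ where
  func := ⟨fun f => c.func ⟨f.1, Sum.inr f.2⟩, fun f g h => by
    obtain ⟨m, f⟩ := f
    obtain ⟨n, g⟩ := g
    have h' := c.func.injective h
    obtain ⟨rfl, h''⟩ := Sigma.mk.inj_iff.1 h'
    exact congrArg (Sigma.mk m) (Sum.inr_injective (eq_of_heq h''))⟩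
  pred := ⟨fun r => c.pred ⟨r.1, Sum.inr r.2⟩, fun r s h => by
    obtain ⟨m, r⟩ := r
    obtain ⟨n, s⟩ := s
    have h' := c.pred.injective h
    obtain ⟨rfl, h''⟩ := Sigma.mk.inj_iff.1 h'
    exact congrArg (Sigma.mk m) (Sum.inr_injective (eq_of_heq h''))⟩

section

variable {L : FirstOrder.Language.{u, v}}

/-- The Gödel number of a term. -/
def termCode (c : Numbering L) {α : Type} [Encodable α] : L.Term α → ℕ
  | .var a => Nat.pair 0 (Encodable.encode a)
  | .func f ts =>
    Nat.pair 1 (Nat.pair (c.func ⟨_, f⟩)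
      (Encodable.encode (List.ofFn fun i => termCode c (ts i))))

/-- The Gödel number of a formula whose free variables are indexed by the natural numbers. -/
def formulaCode (c : Numbering L) : {n : ℕ} → L.BoundedFormula ℕ n → ℕ
  | _, .falsum => Nat.pair 0 0
  | _, .equal s t => Nat.pair 1 (Nat.pair (termCode c s) (termCode c t))
  | _, .rel R ts =>
    Nat.pair 2 (Nat.pair (c.pred ⟨_, R⟩)
      (Encodable.encode (List.ofFn fun i => termCode c (ts i))))
  | _, .imp φ ψ => Nat.pair 3 (Nat.pair (formulaCode c φ) (formulaCode c ψ))
  | _, .all φ => Nat.pair 4 (formulaCode c φ)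

/-- A set `S` of quantifier-free formulas is decidable if the set of the Gödel numbers of its
members is a decidable set of natural numbers. -/
def DecidableSet (c : Numbering L) (S : L.Formula ℕ → Prop) : Prop :=
  ComputablePred fun k : ℕ =>
    ∃ φ : L.Formula ℕ, φ.IsQF ∧ formulaCode c φ = k ∧ S φ

/-- `φ` is satisfied by an interpretation of `T`: a model of `T` with values for the variables. -/
def IsSat (T : L.Theory) (φ : L.Formula ℕ) : Prop :=
  ∃ (M : Type) (_ : L.Structure M) (x : ℕ → M), M ⊨ T ∧ φ.Realize x

/-- `φ` is satisfied by an infinite interpretation of `T`. -/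
def IsInfinitelySat (T : L.Theory) (φ : L.Formula ℕ) : Prop :=
  ∃ (M : Type) (_ : L.Structure M) (x : ℕ → M), Infinite M ∧ M ⊨ T ∧ φ.Realize x

/-- It is decidable whether a quantifier-free formula is satisfiable in `T`. -/
def DecidableTheory (c : Numbering L) (T : L.Theory) : Prop :=
  DecidableSet c (IsSat T)

/-- It is decidable whether a quantifier-free formula is satisfied by an infinite interpretation
of `T`. -/
def InfinitelyDecidable (c : Numbering L) (T : L.Theory) : Prop :=
  DecidableSet c (IsInfinitelySat T)

/-- Satisfying interpretations can be replaced by ones of any larger cardinality. -/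
def Smooth (T : L.Theory) : Prop :=
  ∀ φ : L.Formula ℕ, φ.IsQF →
    ∀ (M : Type) [L.Structure M] (x : ℕ → M), M ⊨ T → φ.Realize x →
      ∀ κ : Cardinal.{0}, #M < κ →
        ∃ (N : Type) (_ : L.Structure N) (y : ℕ → N), N ⊨ T ∧ φ.Realize y ∧ #N = κ

/-- `minmod` gives, for each satisfiable quantifier-free formula, the least cardinality of an
interpretation of `T` that satisfies it; here `⊤` stands for `ℵ₀`. -/
def IsMinimalModelFunction (T : L.Theory) (minmod : L.Formula ℕ → ℕ∞) : Prop :=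
  ∀ φ : L.Formula ℕ, φ.IsQF → IsSat T φ →
    (∃ (M : Type) (_ : L.Structure M) (x : ℕ → M),
      M ⊨ T ∧ φ.Realize x ∧ #M = (minmod φ : Cardinal.{0})) ∧
    ∀ (N : Type) [L.Structure N] (y : ℕ → N),
      N ⊨ T → φ.Realize y → (minmod φ : Cardinal.{0}) ≤ #N

/-- A function from quantifier-free formulas to `ℕ ∪ {ℵ₀}` is computable if some partial recursive
function computes its value at `φ` from the Gödel number of `φ`; here the output `none` stands for
`ℵ₀` and `some k` for `k`. -/
def ComputableOnQF (c : Numbering L) (f : L.Formula ℕ → ℕ∞) : Prop :=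
  ∃ g : ℕ →. Option ℕ, Partrec g ∧
    ∀ φ : L.Formula ℕ, φ.IsQF →
      ∃ o ∈ g (formulaCode c φ), f φ = o.elim ⊤ fun k : ℕ => (k : ℕ∞)

def HasComputableMinimalModelFunction (c : Numbering L) (T : L.Theory) : Prop :=
  ∃ minmod : L.Formula ℕ → ℕ∞, IsMinimalModelFunction T minmod ∧ ComputableOnQF c minmod

end

/-- The theory over `L₁ ∪ L₂` axiomatized by the axioms of `T₁` together with those of `T₂`. -/
def combine {L₁ : FirstOrder.Language.{u, v}} {L₂ : FirstOrder.Language.{u', v'}} (T₁ : L₁.Theory) (T₂ : L₂.Theory) :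
    (L₁.sum L₂).Theory :=
  (FirstOrder.Language.LHom.sumInl : L₁ →ᴸ L₁.sum L₂).onTheory T₁ ∪
    (FirstOrder.Language.LHom.sumInr : L₂ →ᴸ L₁.sum L₂).onTheory T₂

end TheoryCombination

/-!
Guess the truth values of all codes below a bound. They decide which of these codes, read as terms,
have equal values, so models of `T₁` and `T₂` in which the guess is correct can be glued along a
bijection of their domains, provided that the domains have the same cardinality. The part of the
guess about `T₁` is one quantifier-free formula, its diagram; as `T₁` is smooth, the cardinalities
in which it is satisfiable are exactly those from the value of the minimal model function on. It
thus remains to decide whether the diagram for `T₂` has a model at least that large. For the value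
`ℵ₀` this is infinite decidability; for a finite value `m` it is the satisfiability of the diagram
together with the inequations between `m` fresh variables.
-/

namespace TheoryCombination

open FirstOrder.Language FirstOrder.Language.Structure

section Computability

variable {α β σ : Type*} [Primcodable α] [Primcodable β] [Primcodable σ]

theorem computablePred_comp {p : β → Prop} {f : α → β} (hp : ComputablePred p)
    (hf : Computable f) : ComputablePred fun a => p (f a) := by
  classical
  exact (hp.decide.comp hf).computablePred

theorem computablePred_and {p q : α → Prop} (hp : ComputablePred p) (hq : ComputablePred q) :
    ComputablePred fun a => p a ∧ q a := by
  classical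
  exact ((Primrec.and.to_comp.comp hp.decide hq.decide).of_eq fun a => by simp).computablePred

theorem computablePred_or {p q : α → Prop} (hp : ComputablePred p) (hq : ComputablePred q) :
    ComputablePred fun a => p a ∨ q a := by
  classical
  exact ((Primrec.or.to_comp.comp hp.decide hq.decide).of_eq fun a => by simp).computablePred

theorem computablePred_imp {p q : α → Prop} (hp : ComputablePred p) (hq : ComputablePred q) :
    ComputablePred fun a => p a → q a :=
  (computablePred_or hp.not hq).of_eq fun _ => imp_iff_not_or.symm

theorem computablePred_iff {p q : α → Prop} (hp : ComputablePred p) (hq : ComputablePred q) :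
    ComputablePred fun a => (p a ↔ q a) :=
  (computablePred_and (computablePred_imp hp hq) (computablePred_imp hq hp)).of_eq fun _ =>
    iff_iff_implies_and_implies.symm

theorem computablePred_eq {f g : α → β} (hf : Computable f) (hg : Computable g) :
    ComputablePred fun a => f a = g a :=
  computablePred_comp (p := fun x : β × β => x.1 = x.2)
    (PrimrecPred.computablePred Primrec.eq) (hf.pair hg)

theorem computable_ite {p : α → Prop} [DecidablePred p] {f g : α → σ} (hp : ComputablePred p)
    (hf : Computable f) (hg : Computable g) : Computable fun a => if p a then f a else g a :=
  (Computable.cond hp.decide hf hg).of_eq fun a => by by_cases h : p a <;> simp [h]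

theorem computablePred_forall_lt {p : α → ℕ → Prop} {f : α → ℕ} (hf : Computable f)
    (hp : ComputablePred fun x : α × ℕ => p x.1 x.2) :
    ComputablePred fun a => ∀ i < f a, p a i := by
  classical
  have hrec : Computable fun a => (Nat.rec true (fun i b => b && decide (p a i)) (f a) : Bool) :=
    Computable.nat_rec hf (Computable.const true)
      (Primrec.and.to_comp.comp (Computable.snd.comp Computable.snd)
        (hp.decide.comp (Computable.fst.pair (Computable.fst.comp Computable.snd)))).to₂
  refine (hrec.of_eq fun a => ?_ : Computable fun a => decide (∀ i < f a, p a i)).computablePred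
  generalize f a = n
  induction n with
  | zero => simp
  | succ n ih => simp only [ih, Nat.forall_lt_succ_right, Bool.decide_and]

theorem computablePred_exists_lt {p : α → ℕ → Prop} {f : α → ℕ} (hf : Computable f)
    (hp : ComputablePred fun x : α × ℕ => p x.1 x.2) :
    ComputablePred fun a => ∃ i < f a, p a i :=
  (computablePred_forall_lt (p := fun a i => ¬p a i) hf hp.not).not.of_eq fun a => by simp

theorem computablePred_forall_mem_list {p : α → β → Prop} {l : α → List β}
    (hl : Computable l) (hp : ComputablePred fun x : α × β => p x.1 x.2) :
    ComputablePred fun a => ∀ b ∈ l a, p a b := by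
  cases isEmpty_or_nonempty β
  · exact (computablePred_eq (Computable.const ()) (Computable.const ())).of_eq fun a => by simp
  inhabit β
  refine (computablePred_forall_lt (p := fun a i => p a ((l a).getI i))
    (Primrec.list_length.to_comp.comp hl) (computablePred_comp hp (Computable.fst.pair
      (Primrec.list_getI.to_comp.comp (hl.comp Computable.fst) Computable.snd)))).of_eq fun a => ?_
  rw [List.forall_mem_iff_getElem]
  exact forall₂_congr fun i hi => by rw [List.getI_eq_getElem _ hi]

theorem computablePred_of_strong_rec {p : ℕ → Prop} {step : ℕ → (ℕ → Prop) → Prop}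
    (hstep : ComputablePred fun x : ℕ × List Bool => step x.1 fun i => x.2.getI i = true)
    (hp : ∀ (n : ℕ) (r : ℕ → Prop), (∀ i < n, r i ↔ p i) → (step n r ↔ p n)) :
    ComputablePred p := by
  classical
  have hrec := Computable.nat_strong_rec (fun (_ : Unit) n => decide (p n))
    (g := fun _ l => some (decide (step l.length fun i => l.getI i = true)))
    (Computable.option_some.comp (hstep.decide.comp
      ((Primrec.list_length.to_comp.comp Computable.snd).pair Computable.snd))).to₂
    fun _ n => by
      rw [Option.some_inj, decide_eq_decide, List.length_map, List.length_range]
      refine hp n _ fun i hi => ?_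
      rw [List.getI_eq_getElem _ (by simpa using hi)]
      simp
  exact (hrec.comp (Computable.const ()) Computable.id).computablePred

theorem computable_two_pow : Computable fun k : ℕ => 2 ^ k :=
  (Primrec₂.unpaired'.1 Nat.Primrec.pow).to_comp.comp (Computable.const 2) Computable.id

theorem computablePred_testBit {f g : α → ℕ} (hf : Computable f) (hg : Computable g) :
    ComputablePred fun a => (f a).testBit (g a) = true := by
  refine (computablePred_eq (Primrec.nat_mod.to_comp.comp
    (Primrec.nat_div.to_comp.comp hf (computable_two_pow.comp hg)) (Computable.const 2))
    (Computable.const 1)).of_eq fun a => ?_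
  simp [Nat.testBit_eq_decide_div_mod_eq]

end Computability

theorem exists_testBit_iff (p : ℕ → Prop) (n : ℕ) :
    ∃ m < 2 ^ n, ∀ i < n, m.testBit i = true ↔ p i := by
  classical
  refine ⟨Nat.ofBits fun i : Fin n => decide (p i), Nat.ofBits_lt_two_pow _, fun i hi => ?_⟩
  rw [Nat.testBit_ofBits_lt _ _ hi, decide_eq_true_iff]

theorem exists_equiv_extending {ι : Type*} {M N : Type u} (hMN : #M = #N) (x : ι → M) (y : ι → N)
    {s : Set ι} (hs : s.Finite) (hxy : ∀ i ∈ s, ∀ j ∈ s, (x i = x j ↔ y i = y j)) :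
    ∃ e : M ≃ N, ∀ i ∈ s, e (x i) = y i := by
  obtain ⟨e₀⟩ := Cardinal.eq.1 hMN
  choose index index_mem x_index using fun a : x '' s => a.2
  let f : x '' s ↪ N := ⟨fun a => y (index a), fun a b hab => Subtype.ext <| by
    rw [← x_index a, ← x_index b]
    exact (hxy _ (index_mem a) _ (index_mem b)).2 hab⟩
  obtain ⟨e, he⟩ : ∃ e : M ≃ N, ∀ a : x '' s, e a = f a := by
    cases finite_or_infinite M
    · exact Cardinal.extend_function_finite f ⟨e₀⟩
    · exact Cardinal.extend_function_of_lt f ((Cardinal.lt_aleph0_iff_set_finite.2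
        (hs.image x)).trans_le (Cardinal.aleph0_le_mk M)) ⟨e₀⟩
  refine ⟨e, fun i hi => (he ⟨x i, i, hi, rfl⟩).trans ?_⟩
  exact (hxy _ (index_mem _) _ hi).1 (x_index _)

section Codes

/-- The Gödel number of the variable `x_a`. -/
def varCode (a : ℕ) : ℕ := Nat.pair 0 (2 * a)

/-- The Gödel number of the term with head symbol number `i` and arguments coded by `l`. -/
def funcCode (i : ℕ) (l : List ℕ) : ℕ := Nat.pair 1 (Nat.pair i (Encodable.encode l))

/-- The Gödel number of falsity. -/
def botCode : ℕ := Nat.pair 0 0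

/-- The Gödel number of an equation between the terms coded by `s` and `t`. -/
def eqCode (s t : ℕ) : ℕ := Nat.pair 1 (Nat.pair s t)

/-- The Gödel number of the atom with predicate number `i` and arguments coded by `l`. -/
def relCode (i : ℕ) (l : List ℕ) : ℕ := Nat.pair 2 (Nat.pair i (Encodable.encode l))

/-- The Gödel number of an implication. -/
def impCode (a b : ℕ) : ℕ := Nat.pair 3 (Nat.pair a b)

/-- The Gödel number of a negation. -/
def notCode (a : ℕ) : ℕ := impCode a botCode

/-- The Gödel number of a conjunction. -/
def andCode (a b : ℕ) : ℕ := notCode (impCode a (notCode b))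

/-- The Gödel number of the conjunction of the formulas coded by `a 0, …, a (n - 1)`. -/
def conjCode (a : ℕ → ℕ) : ℕ → ℕ
  | 0 => notCode botCode
  | n + 1 => andCode (a n) (conjCode a n)

/-- The constructor tag of a Gödel number. Terms and formulas share tags: `1` stands for function
applications and for equations. -/
def codeTag (k : ℕ) : ℕ := k.unpair.1

/-- The first component below the tag: the number of a head symbol, or the first subformula. -/
def codeFst (k : ℕ) : ℕ := k.unpair.2.unpair.1

/-- The second component below the tag. -/
def codeSnd (k : ℕ) : ℕ := k.unpair.2.unpair.2

/-- The second component below the tag, read as a list of arguments. -/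
def codeArgs (k : ℕ) : List ℕ := Denumerable.ofNat (List ℕ) (codeSnd k)

@[simp] theorem codeTag_varCode (a : ℕ) : codeTag (varCode a) = 0 := by simp [codeTag, varCode]
@[simp] theorem codeTag_funcCode (i : ℕ) (l : List ℕ) : codeTag (funcCode i l) = 1 := by
  simp [codeTag, funcCode]
@[simp] theorem codeTag_botCode : codeTag botCode = 0 := by simp [codeTag, botCode]
@[simp] theorem codeTag_eqCode (s t : ℕ) : codeTag (eqCode s t) = 1 := by simp [codeTag, eqCode]
@[simp] theorem codeTag_relCode (i : ℕ) (l : List ℕ) : codeTag (relCode i l) = 2 := by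
  simp [codeTag, relCode]
@[simp] theorem codeTag_impCode (a b : ℕ) : codeTag (impCode a b) = 3 := by
  simp [codeTag, impCode]
@[simp] theorem codeFst_funcCode (i : ℕ) (l : List ℕ) : codeFst (funcCode i l) = i := by
  simp [codeFst, funcCode]
@[simp] theorem codeFst_relCode (i : ℕ) (l : List ℕ) : codeFst (relCode i l) = i := by
  simp [codeFst, relCode]
@[simp] theorem codeFst_eqCode (s t : ℕ) : codeFst (eqCode s t) = s := by simp [codeFst, eqCode]
@[simp] theorem codeFst_impCode (a b : ℕ) : codeFst (impCode a b) = a := by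
  simp [codeFst, impCode]
@[simp] theorem codeSnd_eqCode (s t : ℕ) : codeSnd (eqCode s t) = t := by simp [codeSnd, eqCode]
@[simp] theorem codeSnd_impCode (a b : ℕ) : codeSnd (impCode a b) = b := by
  simp [codeSnd, impCode]
@[simp] theorem codeArgs_funcCode (i : ℕ) (l : List ℕ) : codeArgs (funcCode i l) = l := by
  simp [codeArgs, codeSnd, funcCode]
@[simp] theorem codeArgs_relCode (i : ℕ) (l : List ℕ) : codeArgs (relCode i l) = l := by
  simp [codeArgs, codeSnd, relCode]

theorem pair_codeTag (k : ℕ) : Nat.pair (codeTag k) (Nat.pair (codeFst k) (codeSnd k)) = k := by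
  simp [codeTag, codeFst, codeSnd]

theorem funcCode_eta {k : ℕ} (hk : codeTag k = 1) : funcCode (codeFst k) (codeArgs k) = k := by
  conv_rhs => rw [← pair_codeTag k, hk]
  simp [funcCode, codeArgs]

theorem eqCode_eta {k : ℕ} (hk : codeTag k = 1) : eqCode (codeFst k) (codeSnd k) = k := by
  conv_rhs => rw [← pair_codeTag k, hk]
  rfl

theorem relCode_eta {k : ℕ} (hk : codeTag k = 2) : relCode (codeFst k) (codeArgs k) = k := by
  conv_rhs => rw [← pair_codeTag k, hk]
  simp [relCode, codeArgs]

theorem impCode_eta {k : ℕ} (hk : codeTag k = 3) : impCode (codeFst k) (codeSnd k) = k := by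
  conv_rhs => rw [← pair_codeTag k, hk]
  rfl

theorem funcCode_inj {i j : ℕ} {l l' : List ℕ} :
    funcCode i l = funcCode j l' ↔ i = j ∧ l = l' := by
  simp [funcCode, Nat.pair_eq_pair]

theorem relCode_inj {i j : ℕ} {l l' : List ℕ} : relCode i l = relCode j l' ↔ i = j ∧ l = l' := by
  simp [relCode, Nat.pair_eq_pair]

theorem eqCode_inj {s t s' t' : ℕ} : eqCode s t = eqCode s' t' ↔ s = s' ∧ t = t' := by
  simp [eqCode, Nat.pair_eq_pair]

theorem impCode_inj {a b a' b' : ℕ} : impCode a b = impCode a' b' ↔ a = a' ∧ b = b' := by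
  simp [impCode, Nat.pair_eq_pair]

theorem lt_encode_of_mem {a : ℕ} {l : List ℕ} (h : a ∈ l) : a < Encodable.encode l := by
  induction l with
  | nil => simp at h
  | cons b l ih =>
    rw [Encodable.encode_list_cons, Nat.lt_succ_iff]
    rcases List.mem_cons.1 h with rfl | h
    · exact Nat.left_le_pair _ _
    · exact (ih h).le.trans (Nat.right_le_pair _ _)

theorem lt_pair_of_pos {a b c : ℕ} (ha : 0 < a) (h : c ≤ b) : c < Nat.pair a b :=
  h.trans_lt ((Nat.lt_add_of_pos_left ha).trans_le (Nat.add_le_pair a b))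

theorem lt_funcCode_of_mem {i t : ℕ} {l : List ℕ} (h : t ∈ l) : t < funcCode i l :=
  lt_pair_of_pos one_pos ((lt_encode_of_mem h).le.trans (Nat.right_le_pair _ _))

theorem lt_relCode_of_mem {i t : ℕ} {l : List ℕ} (h : t ∈ l) : t < relCode i l :=
  lt_pair_of_pos two_pos ((lt_encode_of_mem h).le.trans (Nat.right_le_pair _ _))

theorem left_lt_eqCode (s t : ℕ) : s < eqCode s t :=
  lt_pair_of_pos one_pos (Nat.left_le_pair _ _)

theorem right_lt_eqCode (s t : ℕ) : t < eqCode s t :=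
  lt_pair_of_pos one_pos (Nat.right_le_pair _ _)

theorem left_lt_impCode (a b : ℕ) : a < impCode a b :=
  lt_pair_of_pos three_pos (Nat.left_le_pair _ _)

theorem right_lt_impCode (a b : ℕ) : b < impCode a b :=
  lt_pair_of_pos three_pos (Nat.right_le_pair _ _)

theorem lt_of_mem_codeArgs {k t : ℕ} (hk : codeTag k = 1) (h : t ∈ codeArgs k) : t < k := by
  conv_rhs => rw [← funcCode_eta hk]
  exact lt_funcCode_of_mem h

theorem codeFst_lt {k : ℕ} (hk : codeTag k = 3) : codeFst k < k := by
  conv_rhs => rw [← impCode_eta hk]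
  exact left_lt_impCode _ _

theorem codeSnd_lt {k : ℕ} (hk : codeTag k = 3) : codeSnd k < k := by
  conv_rhs => rw [← impCode_eta hk]
  exact right_lt_impCode _ _

theorem pair_le_pair {a b a' b' : ℕ} (ha : a ≤ a') (hb : b ≤ b') :
    Nat.pair a b ≤ Nat.pair a' b' :=
  calc Nat.pair a b ≤ Nat.pair a' b :=
        (StrictMono.monotone fun _ _ h => Nat.pair_lt_pair_left b h) ha
    _ ≤ Nat.pair a' b' := (StrictMono.monotone fun _ _ h => Nat.pair_lt_pair_right a' h) hb

theorem eqCode_le_eqCode {s t s' t' : ℕ} (hs : s ≤ s') (ht : t ≤ t') :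
    eqCode s t ≤ eqCode s' t' :=
  pair_le_pair le_rfl (pair_le_pair hs ht)

theorem primrec_codeTag : Primrec codeTag := Primrec.fst.comp Primrec.unpair

theorem primrec_codeFst : Primrec codeFst :=
  Primrec.fst.comp (Primrec.unpair.comp (Primrec.snd.comp Primrec.unpair))

theorem primrec_codeSnd : Primrec codeSnd :=
  Primrec.snd.comp (Primrec.unpair.comp (Primrec.snd.comp Primrec.unpair))

theorem primrec_codeArgs : Primrec codeArgs := (Primrec.ofNat (List ℕ)).comp primrec_codeSnd

theorem primrec_varCode : Primrec varCode :=
  Primrec₂.natPair.comp (Primrec.const 0) (Primrec.nat_mul.comp (Primrec.const 2) Primrec.id)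

theorem primrec₂_funcCode : Primrec₂ funcCode :=
  Primrec₂.natPair.comp₂ (Primrec₂.const 1)
    (Primrec₂.natPair.comp₂ Primrec₂.left (Primrec.encode.comp₂ Primrec₂.right))

theorem primrec₂_relCode : Primrec₂ relCode :=
  Primrec₂.natPair.comp₂ (Primrec₂.const 2)
    (Primrec₂.natPair.comp₂ Primrec₂.left (Primrec.encode.comp₂ Primrec₂.right))

theorem primrec₂_eqCode : Primrec₂ eqCode :=
  Primrec₂.natPair.comp₂ (Primrec₂.const 1) Primrec₂.natPair

theorem primrec₂_impCode : Primrec₂ impCode :=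
  Primrec₂.natPair.comp₂ (Primrec₂.const 3) Primrec₂.natPair

theorem primrec_notCode : Primrec notCode :=
  primrec₂_impCode.comp Primrec.id (Primrec.const botCode)

theorem primrec₂_andCode : Primrec₂ andCode :=
  primrec_notCode.comp₂
    (primrec₂_impCode.comp₂ Primrec₂.left (primrec_notCode.comp₂ Primrec₂.right))

theorem computable_conjCode {α : Type*} [Primcodable α] {a : α → ℕ → ℕ} {n : α → ℕ}
    (ha : Computable₂ a) (hn : Computable n) : Computable fun x => conjCode (a x) (n x) := by
  have hrec : Computable fun x =>
      (Nat.rec (notCode botCode) (fun i b => andCode (a x i) b) (n x) : ℕ) :=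
    Computable.nat_rec (h := fun x y => andCode (a x y.1) y.2) hn (Computable.const _)
      (primrec₂_andCode.to_comp.comp
        (ha.comp Computable.fst (Computable.fst.comp Computable.snd))
        (Computable.snd.comp Computable.snd)).to₂
  refine hrec.of_eq fun x => ?_
  generalize n x = n
  induction n with
  | zero => rfl
  | succ n ih => simp only [conjCode, ih]

end Codes

section Formulas

variable {L : FirstOrder.Language.{u, v}} (c : Numbering L)

/-- The number `i` belongs to a function symbol of arity `n`. -/
def Numbering.IsFunc (i n : ℕ) : Prop := ∃ f : L.Functions n, c.func ⟨n, f⟩ = i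

/-- The number `i` belongs to a predicate symbol of arity `n`. -/
def Numbering.IsPred (i n : ℕ) : Prop := ∃ R : L.Relations n, c.pred ⟨n, R⟩ = i

/-- The arities of the symbols can be computed from their numbers, and it is decidable which numbers
belong to a symbol. -/
structure Numbering.DecidableArities : Prop where
  func : ComputablePred fun x : ℕ × ℕ => c.IsFunc x.1 x.2
  pred : ComputablePred fun x : ℕ × ℕ => c.IsPred x.1 x.2

/-- The number `k` is the code of a term over the variables. -/
def IsTermCode (k : ℕ) : Prop := ∃ t : L.Term (ℕ ⊕ Fin 0), termCode c t = k

/-- The number `k` is the code of a quantifier-free formula with the property `S`; the set `S` is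
decidable exactly if this predicate of `k` is. -/
def HasCode (S : L.Formula ℕ → Prop) (k : ℕ) : Prop :=
  ∃ φ : L.Formula ℕ, φ.IsQF ∧ formulaCode c φ = k ∧ S φ

/-- The number `k` is the code of a quantifier-free formula. -/
def IsQFCode (k : ℕ) : Prop := HasCode c (fun _ => True) k

theorem termCode_var_inl (a : ℕ) {n : ℕ} :
    termCode c (Term.var (Sum.inl a) : L.Term (ℕ ⊕ Fin n)) = varCode a := by
  simp [termCode, varCode, Encodable.encode_inl]

theorem termCode_func {α : Type} [Encodable α] {n : ℕ} (f : L.Functions n)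
    (ts : Fin n → L.Term α) :
    termCode c (Term.func f ts) = funcCode (c.func ⟨n, f⟩) (List.ofFn fun i => termCode c (ts i)) :=
  rfl

theorem formulaCode_equal {n : ℕ} (s t : L.Term (ℕ ⊕ Fin n)) :
    formulaCode c (BoundedFormula.equal s t) = eqCode (termCode c s) (termCode c t) := rfl

theorem formulaCode_rel {n m : ℕ} (R : L.Relations m) (ts : Fin m → L.Term (ℕ ⊕ Fin n)) :
    formulaCode c (BoundedFormula.rel R ts) =
      relCode (c.pred ⟨m, R⟩) (List.ofFn fun i => termCode c (ts i)) := rfl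

theorem formulaCode_imp {n : ℕ} (φ ψ : L.BoundedFormula ℕ n) :
    formulaCode c (φ.imp ψ) = impCode (formulaCode c φ) (formulaCode c ψ) := rfl

theorem termCode_injective {α : Type} [Encodable α] :
    Function.Injective (termCode c : L.Term α → ℕ) := by
  intro s
  induction s with
  | var a =>
    rintro (b | _) h
    · simpa [termCode, Nat.pair_eq_pair] using h
    · simp [termCode, Nat.pair_eq_pair] at h
  | func f ts ih =>
    rintro (_ | ⟨g, us⟩) h
    · simp [termCode, Nat.pair_eq_pair] at h
    · rw [termCode_func, termCode_func, funcCode_inj] at h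
      obtain ⟨hfg, hargs⟩ := h
      obtain ⟨rfl, hfg⟩ := Sigma.mk.inj_iff.1 (c.func.injective hfg)
      obtain rfl := eq_of_heq hfg
      congr 1
      funext i
      exact ih i (congrFun (List.ofFn_injective hargs) i)

theorem formulaCode_injective {n : ℕ} :
    Function.Injective (formulaCode c : L.BoundedFormula ℕ n → ℕ) := by
  intro φ
  induction φ with
  | falsum => intro ψ h; cases ψ <;> simp [formulaCode, Nat.pair_eq_pair] at h ⊢
  | equal s t =>
    intro ψ h
    cases ψ with
    | equal s' t' =>
      rw [formulaCode_equal, formulaCode_equal, eqCode_inj] at h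
      rw [termCode_injective c h.1, termCode_injective c h.2]
    | _ => simp [formulaCode, Nat.pair_eq_pair] at h
  | rel R ts =>
    intro ψ h
    cases ψ with
    | rel R' us =>
      rw [formulaCode_rel, formulaCode_rel, relCode_inj] at h
      obtain ⟨hR, hargs⟩ := h
      obtain ⟨rfl, hR⟩ := Sigma.mk.inj_iff.1 (c.pred.injective hR)
      obtain rfl := eq_of_heq hR
      congr 1
      funext i
      exact termCode_injective c (congrFun (List.ofFn_injective hargs) i)
    | _ => simp [formulaCode, Nat.pair_eq_pair] at h
  | imp φ₁ φ₂ ih₁ ih₂ =>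
    intro ψ h
    cases ψ with
    | imp ψ₁ ψ₂ =>
      rw [formulaCode_imp, formulaCode_imp, impCode_inj] at h
      rw [ih₁ h.1, ih₂ h.2]
    | _ => simp [formulaCode, Nat.pair_eq_pair] at h
  | all φ ih =>
    intro ψ h
    cases ψ with
    | all ψ =>
      simp only [formulaCode, Nat.pair_eq_pair, true_and] at h
      rw [ih h]
    | _ => simp [formulaCode, Nat.pair_eq_pair] at h

theorem hasCode_formulaCode {S : L.Formula ℕ → Prop} {φ : L.Formula ℕ} (hφ : φ.IsQF) :
    HasCode c S (formulaCode c φ) ↔ S φ :=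
  ⟨fun ⟨_, _, h, hS⟩ => formulaCode_injective c h ▸ hS, fun h => ⟨φ, hφ, rfl, h⟩⟩

theorem isTermCode_varCode (a : ℕ) : IsTermCode c (varCode a) :=
  ⟨Term.var (Sum.inl a), termCode_var_inl c a⟩

theorem isTermCode_funcCode {i : ℕ} {l : List ℕ} :
    IsTermCode c (funcCode i l) ↔ c.IsFunc i l.length ∧ ∀ t ∈ l, IsTermCode c t := by
  constructor
  · rintro ⟨_ | ⟨f, ts⟩, ht⟩
    · simp [termCode, funcCode, Nat.pair_eq_pair] at ht
    · rw [termCode_func, funcCode_inj] at ht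
      obtain ⟨rfl, rfl⟩ := ht
      exact ⟨by rw [List.length_ofFn]; exact ⟨f, rfl⟩,
        List.forall_mem_ofFn_iff.2 fun i => ⟨ts i, rfl⟩⟩
  · rintro ⟨⟨f, rfl⟩, h⟩
    choose t ht using fun i : Fin l.length => h (l.get i) (List.get_mem l i)
    exact ⟨Term.func f t, by rw [termCode_func]; simp only [ht, List.ofFn_get]⟩

theorem isTermCode_iff (k : ℕ) : IsTermCode c k ↔
    (codeTag k = 0 ∧ k.unpair.2 % 2 = 0) ∨
      (codeTag k = 1 ∧ c.IsFunc (codeFst k) (codeArgs k).length ∧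
        ∀ t ∈ codeArgs k, IsTermCode c t) := by
  constructor
  · rintro ⟨(a | a) | ⟨f, ts⟩, rfl⟩
    · left
      rw [termCode_var_inl]
      simp [varCode, codeTag]
    · exact a.elim0
    · right
      have h := (isTermCode_funcCode c).1 ⟨Term.func f ts, termCode_func c f ts⟩
      simpa [termCode_func] using h
  · rintro (⟨htag, heven⟩ | ⟨htag, h⟩)
    · have hk : k = varCode (k.unpair.2 / 2) := by
        rw [varCode, Nat.mul_div_cancel' (Nat.dvd_of_mod_eq_zero heven), ← htag, codeTag,
          Nat.pair_unpair]
      rw [hk]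
      exact isTermCode_varCode c _
    · rw [← funcCode_eta htag]
      exact (isTermCode_funcCode c).2 h

theorem isQFCode_iff (k : ℕ) : IsQFCode c k ↔
    k = botCode ∨ (codeTag k = 1 ∧ IsTermCode c (codeFst k) ∧ IsTermCode c (codeSnd k)) ∨
      (codeTag k = 2 ∧ c.IsPred (codeFst k) (codeArgs k).length ∧
        ∀ t ∈ codeArgs k, IsTermCode c t) ∨
      (codeTag k = 3 ∧ IsQFCode c (codeFst k) ∧ IsQFCode c (codeSnd k)) := by
  constructor
  · rintro ⟨φ, hφ, rfl, -⟩
    cases hφ with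
    | falsum => exact Or.inl rfl
    | of_isAtomic h =>
      cases h with
      | equal s t =>
        rw [show formulaCode c (s.bdEqual t) = _ from formulaCode_equal c s t]
        simp [IsTermCode]
      | rel R ts =>
        rw [show formulaCode c (R.boundedFormula ts) = _ from formulaCode_rel c R ts]
        have hR : c.IsPred (c.pred ⟨_, R⟩) _ := ⟨R, rfl⟩
        simp [IsTermCode, hR]
    | imp hφ hψ =>
      rw [formulaCode_imp]
      simpa using Or.inr ⟨⟨_, hφ, rfl, trivial⟩, ⟨_, hψ, rfl, trivial⟩⟩
  · rintro (rfl | ⟨h, ⟨s, hs⟩, t, ht⟩ | ⟨h, ⟨R, hR⟩, hargs⟩ |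
      ⟨h, ⟨φ, hφ, hφk, -⟩, ψ, hψ, hψk, -⟩)
    · exact ⟨_, .falsum, rfl, trivial⟩
    · refine ⟨_, (BoundedFormula.IsAtomic.equal s t).isQF, ?_, trivial⟩
      rw [← eqCode_eta h, ← hs, ← ht]
      rfl
    · choose t ht using fun i => hargs ((codeArgs k).get i) (List.get_mem _ i)
      refine ⟨_, (BoundedFormula.IsAtomic.rel R t).isQF, ?_, trivial⟩
      refine (formulaCode_rel c R t).trans ?_
      simp only [hR, ht, List.ofFn_get]
      exact relCode_eta h
    · exact ⟨_, hφ.imp hψ, by rw [formulaCode_imp, hφk, hψk, impCode_eta h], trivial⟩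

theorem isQFCode_eqCode {s t : ℕ} :
    IsQFCode c (eqCode s t) ↔ IsTermCode c s ∧ IsTermCode c t := by
  rw [isQFCode_iff]
  have h : eqCode s t ≠ botCode := by simp [eqCode, botCode, Nat.pair_eq_pair]
  simp [h]

theorem isQFCode_relCode {i : ℕ} {l : List ℕ} :
    IsQFCode c (relCode i l) ↔ c.IsPred i l.length ∧ ∀ t ∈ l, IsTermCode c t := by
  rw [isQFCode_iff]
  have h : relCode i l ≠ botCode := by simp [relCode, botCode, Nat.pair_eq_pair]
  simp [h]

theorem isQFCode_impCode {a b : ℕ} :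
    IsQFCode c (impCode a b) ↔ IsQFCode c a ∧ IsQFCode c b := by
  rw [isQFCode_iff]
  have h : impCode a b ≠ botCode := by simp [impCode, botCode, Nat.pair_eq_pair]
  simp [h]

variable {c}

theorem HasCode.isQFCode {S : L.Formula ℕ → Prop} {k : ℕ} (h : HasCode c S k) : IsQFCode c k :=
  let ⟨φ, hφ, hk, _⟩ := h
  ⟨φ, hφ, hk, trivial⟩

theorem computablePred_isTermCode (hc : c.DecidableArities) : ComputablePred (IsTermCode c) := by
  have htag (i : ℕ) : ComputablePred fun x : ℕ × List Bool => codeTag x.1 = i :=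
    computablePred_eq (primrec_codeTag.to_comp.comp Computable.fst) (Computable.const i)
  have hargs : Computable fun x : ℕ × List Bool => codeArgs x.1 :=
    primrec_codeArgs.to_comp.comp Computable.fst
  refine computablePred_of_strong_rec (step := fun k r => (codeTag k = 0 ∧ k.unpair.2 % 2 = 0) ∨
    (codeTag k = 1 ∧ c.IsFunc (codeFst k) (codeArgs k).length ∧ ∀ t ∈ codeArgs k, r t)) ?_ ?_
  · refine computablePred_or (computablePred_and (htag 0) ?_)
      (computablePred_and (htag 1) (computablePred_and ?_ ?_))
    · exact computablePred_eq (Primrec.nat_mod.to_comp.comp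
        (Computable.snd.comp (Computable.unpair.comp Computable.fst)) (Computable.const 2))
        (Computable.const 0)
    · exact computablePred_comp hc.func ((primrec_codeFst.to_comp.comp Computable.fst).pair
        (Primrec.list_length.to_comp.comp hargs))
    · exact computablePred_forall_mem_list (p := fun x t => x.2.getI t = true) hargs
        (computablePred_eq (Primrec.list_getI.to_comp.comp
          (Computable.snd.comp Computable.fst) Computable.snd) (Computable.const true))
  · intro k r hr
    rw [isTermCode_iff]
    exact or_congr_right (and_congr_right fun htag => and_congr_right fun _ =>
      forall₂_congr fun t ht => hr t (lt_of_mem_codeArgs htag ht))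

theorem computablePred_isQFCode (hc : c.DecidableArities) : ComputablePred (IsQFCode c) := by
  have htag (i : ℕ) : ComputablePred fun x : ℕ × List Bool => codeTag x.1 = i :=
    computablePred_eq (primrec_codeTag.to_comp.comp Computable.fst) (Computable.const i)
  have hfst : Computable fun x : ℕ × List Bool => codeFst x.1 :=
    primrec_codeFst.to_comp.comp Computable.fst
  have hsnd : Computable fun x : ℕ × List Bool => codeSnd x.1 :=
    primrec_codeSnd.to_comp.comp Computable.fst
  have hargs : Computable fun x : ℕ × List Bool => codeArgs x.1 :=
    primrec_codeArgs.to_comp.comp Computable.fst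
  have hterm := computablePred_isTermCode hc
  have hget {f : ℕ × List Bool → ℕ} (hf : Computable f) :
      ComputablePred fun x : ℕ × List Bool => x.2.getI (f x) = true :=
    computablePred_eq (Primrec.list_getI.to_comp.comp Computable.snd hf) (Computable.const true)
  refine computablePred_of_strong_rec (step := fun k r => k = botCode ∨
    (codeTag k = 1 ∧ IsTermCode c (codeFst k) ∧ IsTermCode c (codeSnd k)) ∨
    (codeTag k = 2 ∧ c.IsPred (codeFst k) (codeArgs k).length ∧
      ∀ t ∈ codeArgs k, IsTermCode c t) ∨
    (codeTag k = 3 ∧ r (codeFst k) ∧ r (codeSnd k))) ?_ ?_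
  · refine computablePred_or (computablePred_eq Computable.fst (Computable.const botCode))
      (computablePred_or (computablePred_and (htag 1) ?equation)
        (computablePred_or (computablePred_and (htag 2) ?relation)
          (computablePred_and (htag 3) (computablePred_and (hget hfst) (hget hsnd)))))
    case equation =>
      exact computablePred_and (computablePred_comp hterm hfst) (computablePred_comp hterm hsnd)
    case relation =>
      exact computablePred_and
        (computablePred_comp hc.pred (hfst.pair (Primrec.list_length.to_comp.comp hargs)))
        (computablePred_forall_mem_list hargs (computablePred_comp hterm Computable.snd))
  · intro k r hr
    rw [isQFCode_iff]
    refine or_congr_right (or_congr_right (or_congr_right (and_congr_right fun htag => ?_)))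
    rw [hr _ (codeFst_lt htag), hr _ (codeSnd_lt htag)]

theorem hasCode_isSat_impCode_self {T : L.Theory} (hT : IsSat T ⊤) (k : ℕ) :
    HasCode c (IsSat T) (impCode k k) ↔ IsQFCode c k := by
  constructor
  · exact fun h => ((isQFCode_impCode c).1 h.isQFCode).1
  · obtain ⟨M, _, x, hM, -⟩ := hT
    rintro ⟨φ, hφ, rfl, -⟩
    exact ⟨φ.imp φ, hφ.imp hφ, rfl, M, _, x, hM, id⟩

theorem DecidableTheory.decidableArities {T : L.Theory} (hdec : DecidableTheory c T)
    (hT : IsSat T ⊤) : c.DecidableArities := by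
  have hqf : ComputablePred (IsQFCode c) :=
    (computablePred_comp hdec (primrec₂_impCode.to_comp.comp Computable.id Computable.id)).of_eq
      (hasCode_isSat_impCode_self hT)
  have hargs : Computable fun x : ℕ × ℕ => List.replicate x.2 (varCode 0) :=
    ((Primrec.list_map (Primrec.list_range.comp Primrec.snd)
      (Primrec.const (varCode 0)).to₂).of_eq fun x => by simp).to_comp
  constructor
  · refine (computablePred_comp hqf (primrec₂_eqCode.to_comp.comp (Computable.const (varCode 0))
      (primrec₂_funcCode.to_comp.comp Computable.fst hargs))).of_eq fun x => ?_
    simp [isQFCode_eqCode, isTermCode_funcCode, isTermCode_varCode]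
  · refine (computablePred_comp hqf
      (primrec₂_relCode.to_comp.comp Computable.fst hargs)).of_eq fun x => ?_
    simp [isQFCode_relCode, isTermCode_varCode]

end Formulas

section Representation

variable {L : FirstOrder.Language.{u, v}}

/-- A property of interpretations, that is, of structures with values for the variables. -/
abbrev InterpretationProperty (L : FirstOrder.Language.{u, v}) :=
  ∀ (M : Type) [L.Structure M], (ℕ → M) → Prop

/-- The number `k` is the code of a quantifier-free formula that expresses `C`. -/
def Represents (c : Numbering L) (k : ℕ) (C : InterpretationProperty L) : Prop :=
  HasCode c (fun φ => ∀ (M : Type) [L.Structure M] (x : ℕ → M), φ.Realize x ↔ C M x) k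

namespace Represents

variable {c : Numbering L} {C D : InterpretationProperty L} {a b : ℕ}

theorem congr (ha : Represents c a C)
    (hCD : ∀ (M : Type) [L.Structure M] (x : ℕ → M), C M x ↔ D M x) : Represents c a D := by
  obtain ⟨φ, hφ, hk, h⟩ := ha
  exact ⟨φ, hφ, hk, fun M _ x => (h M x).trans (hCD M x)⟩

theorem bot : Represents c botCode fun _ _ _ => False :=
  ⟨⊥, BoundedFormula.isQF_bot, rfl, fun _ _ _ => Iff.rfl⟩

theorem imp (ha : Represents c a C) (hb : Represents c b D) :
    Represents c (impCode a b) fun M _ x => C M x → D M x := by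
  obtain ⟨φ, hφ, rfl, h⟩ := ha
  obtain ⟨ψ, hψ, rfl, h'⟩ := hb
  exact ⟨φ.imp ψ, hφ.imp hψ, rfl, fun M _ x => by rw [Formula.realize_imp, h, h']⟩

theorem not (ha : Represents c a C) : Represents c (notCode a) fun M _ x => ¬C M x :=
  ha.imp bot

theorem top : Represents c (notCode botCode) fun _ _ _ => True :=
  bot.not.congr fun _ _ _ => not_false_iff

theorem and (ha : Represents c a C) (hb : Represents c b D) :
    Represents c (andCode a b) fun M _ x => C M x ∧ D M x :=
  (ha.imp hb.not).not.congr fun _ _ _ => by rw [Classical.not_imp, not_not]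

theorem conj {a : ℕ → ℕ} {C : ℕ → InterpretationProperty L} {n : ℕ}
    (ha : ∀ i < n, Represents c (a i) (C i)) :
    Represents c (conjCode a n) fun M _ x => ∀ i < n, C i M x := by
  induction n with
  | zero => exact top.congr fun _ _ _ => by simp
  | succ n ih =>
    exact ((ha n n.lt_succ_self).and (ih fun i hi => ha i (hi.trans n.lt_succ_self))).congr
      fun M _ x => by simp only [Nat.forall_lt_succ_right, and_comm]

theorem var_eq_var (s t : ℕ) :
    Represents c (eqCode (varCode s) (varCode t)) fun _ _ x => x s = x t :=
  ⟨_, (BoundedFormula.IsAtomic.equal (.var (.inl s)) (.var (.inl t))).isQF, by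
    rw [← termCode_var_inl c, ← termCode_var_inl c]; rfl, fun _ _ _ => Iff.rfl⟩

theorem var_eq_func (s : ℕ) {n : ℕ} (f : L.Functions n) (ts : Fin n → ℕ) :
    Represents c (eqCode (varCode s) (funcCode (c.func ⟨n, f⟩) ((List.ofFn ts).map varCode)))
      fun _ _ x => x s = funMap f (x ∘ ts) :=
  ⟨_, (BoundedFormula.IsAtomic.equal (.var (.inl s)) (.func f fun i => .var (.inl (ts i)))).isQF, by
    refine (formulaCode_equal c _ _).trans ?_
    simp only [termCode_var_inl, termCode_func, List.map_ofFn, Function.comp_def],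
    fun _ _ _ => Iff.rfl⟩

theorem rel {n : ℕ} (R : L.Relations n) (ts : Fin n → ℕ) :
    Represents c (relCode (c.pred ⟨n, R⟩) ((List.ofFn ts).map varCode))
      fun _ _ x => RelMap R (x ∘ ts) :=
  ⟨_, (BoundedFormula.IsAtomic.rel R fun i => .var (.inl (ts i))).isQF, by
    refine (formulaCode_rel c _ _).trans ?_
    simp only [termCode_var_inl, List.map_ofFn, Function.comp_def],
    fun _ _ _ => Iff.rfl⟩

theorem hasCode_isSat (ha : Represents c a C) (T : L.Theory) : HasCode c (IsSat T) a ↔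
    ∃ (M : Type) (_ : L.Structure M) (x : ℕ → M), M ⊨ T ∧ C M x := by
  obtain ⟨φ, hφ, rfl, h⟩ := ha
  rw [hasCode_formulaCode c hφ]
  simp only [IsSat, h]

end Represents

end Representation

section Sum

variable {L₁ : FirstOrder.Language.{u₁, v₁}} {L₂ : FirstOrder.Language.{u₂, v₂}}
  {c : Numbering (L₁.sum L₂)}

theorem isFunc_sum_iff (i n : ℕ) : c.IsFunc i n ↔ c.left.IsFunc i n ∨ c.right.IsFunc i n :=
  Sum.exists

theorem isPred_sum_iff (i n : ℕ) : c.IsPred i n ↔ c.left.IsPred i n ∨ c.right.IsPred i n :=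
  Sum.exists

theorem Numbering.DecidableArities.sum (h₁ : c.left.DecidableArities)
    (h₂ : c.right.DecidableArities) : c.DecidableArities :=
  ⟨(computablePred_or h₁.func h₂.func).of_eq fun x => (isFunc_sum_iff x.1 x.2).symm,
    (computablePred_or h₁.pred h₂.pred).of_eq fun x => (isPred_sum_iff x.1 x.2).symm⟩

end Sum

section Evaluation

variable {L : FirstOrder.Language.{u, v}}

/-- In the structure `M`, where `x s` is the value of the code `s` as a term and `b s` its truth
value as a formula, the codes below `n` of function applications and of atomic formulas are
evaluated correctly. The arguments need not be codes of terms: every number below `n` has a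
value. -/
structure Evaluates (c : Numbering L) (b : ℕ → Prop) (n : ℕ) (M : Type*) [L.Structure M]
    (x : ℕ → M) : Prop where
  func : ∀ {m : ℕ} (f : L.Functions m) (ts : Fin m → ℕ),
    funcCode (c.func ⟨m, f⟩) (List.ofFn ts) < n →
      x (funcCode (c.func ⟨m, f⟩) (List.ofFn ts)) = funMap f (x ∘ ts)
  rel : ∀ {m : ℕ} (R : L.Relations m) (ts : Fin m → ℕ),
    relCode (c.pred ⟨m, R⟩) (List.ofFn ts) < n →
      (RelMap R (x ∘ ts) ↔ b (relCode (c.pred ⟨m, R⟩) (List.ofFn ts)))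
  eq : ∀ s t : ℕ, eqCode s t < n → (x s = x t ↔ b (eqCode s t))

/-- The truth values `b` of the codes below `n` respect falsity and implication. -/
structure RespectsConnectives (b : ℕ → Prop) (n : ℕ) : Prop where
  bot : botCode < n → ¬b botCode
  imp : ∀ s t : ℕ, impCode s t < n → (b (impCode s t) ↔ (b s → b t))

variable {c : Numbering L} {b b' : ℕ → Prop} {m n : ℕ} {M N : Type*} [L.Structure M] {x y : ℕ → M}

theorem Evaluates.mono (h : Evaluates c b n M x) (hm : m ≤ n) : Evaluates c b m M x :=
  ⟨fun f ts hlt => h.func f ts (hlt.trans_le hm), fun R ts hlt => h.rel R ts (hlt.trans_le hm),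
    fun s t hlt => h.eq s t (hlt.trans_le hm)⟩

theorem Evaluates.congr (h : Evaluates c b n M x) (hxy : ∀ i < n, x i = y i)
    (hb : ∀ i < n, b i ↔ b' i) : Evaluates c b' n M y := by
  have hcomp {k : ℕ} {ts : Fin k → ℕ} (hts : ∀ i, ts i < n) : x ∘ ts = y ∘ ts :=
    funext fun i => hxy _ (hts i)
  refine ⟨fun f ts hlt => ?_, fun R ts hlt => ?_, fun s t hlt => ?_⟩
  · rw [← hxy _ hlt, h.func f ts hlt,
      hcomp fun i => (lt_funcCode_of_mem (List.mem_ofFn.2 ⟨i, rfl⟩)).trans hlt]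
  · rw [← hb _ hlt, ← h.rel R ts hlt,
      hcomp fun i => (lt_relCode_of_mem (List.mem_ofFn.2 ⟨i, rfl⟩)).trans hlt]
  · rw [← hb _ hlt, ← h.eq s t hlt, hxy _ ((left_lt_eqCode s t).trans hlt),
      hxy _ ((right_lt_eqCode s t).trans hlt)]

theorem Evaluates.induced (h : Evaluates c b n M x) (e : M ≃ N) :
    letI : L.Structure N := e.inducedStructure
    Evaluates c b n N (e ∘ x) := by
  let : L.Structure N := e.inducedStructure
  refine ⟨fun f ts hn => ?_, fun R ts hn => ?_, fun s t hn => ?_⟩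
  · exact (congrArg e (h.func f ts hn)).trans
      ((e.inducedStructureEquiv (L := L)).map_fun f (x ∘ ts))
  · rw [← h.rel R ts hn]
    exact (e.inducedStructureEquiv (L := L)).map_rel R (x ∘ ts)
  · rw [← h.eq s t hn]
    exact e.apply_eq_iff_eq

theorem RespectsConnectives.mono (h : RespectsConnectives b n) (hm : m ≤ n) :
    RespectsConnectives b m :=
  ⟨fun hlt => h.bot (hlt.trans_le hm), fun s t hlt => h.imp s t (hlt.trans_le hm)⟩

theorem RespectsConnectives.congr (h : RespectsConnectives b n) (hb : ∀ i < n, b i ↔ b' i) :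
    RespectsConnectives b' n := by
  refine ⟨fun hlt => (hb _ hlt).not.1 (h.bot hlt), fun s t hlt => ?_⟩
  rw [← hb _ hlt, h.imp s t hlt, hb _ ((left_lt_impCode s t).trans hlt),
    hb _ ((right_lt_impCode s t).trans hlt)]

theorem Evaluates.realize_term (h : Evaluates c b n M x) (z : Fin 0 → M)
    (t : L.Term (ℕ ⊕ Fin 0)) (ht : termCode c t < n) :
    t.realize (Sum.elim (fun a => x (varCode a)) z) = x (termCode c t) := by
  induction t with
  | var a =>
    rcases a with a | a
    · rw [termCode_var_inl]
      rfl
    · exact a.elim0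
  | func f ts ih =>
    rw [termCode_func] at ht ⊢
    rw [h.func f _ ht, Term.realize_func]
    congr 1
    funext i
    exact ih i ((lt_funcCode_of_mem (List.mem_ofFn.2 ⟨i, rfl⟩)).trans ht)

theorem Evaluates.realize_formula (h : Evaluates c b n M x) (hb : RespectsConnectives b n)
    {φ : L.Formula ℕ} (hφ : φ.IsQF) (hn : formulaCode c φ < n) :
    φ.Realize (fun a => x (varCode a)) ↔ b (formulaCode c φ) := by
  induction hφ with
  | falsum => exact iff_of_false id (hb.bot hn)
  | of_isAtomic hφ =>
    cases hφ with
    | equal s t =>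
      have hst : formulaCode c (s.bdEqual t) = _ := formulaCode_equal c s t
      rw [hst] at hn ⊢
      rw [← h.eq _ _ hn, Formula.Realize, BoundedFormula.realize_bdEqual,
        h.realize_term _ _ ((left_lt_eqCode _ _).trans hn),
        h.realize_term _ _ ((right_lt_eqCode _ _).trans hn)]
    | rel R ts =>
      have hR : formulaCode c (R.boundedFormula ts) = _ := formulaCode_rel c R ts
      have hargs : (fun i => (ts i).realize (Sum.elim (fun a => x (varCode a)) default)) =
          x ∘ fun i => termCode c (ts i) := by
        funext i
        exact h.realize_term _ _
          ((lt_relCode_of_mem (List.mem_ofFn.2 ⟨i, rfl⟩)).trans (hR ▸ hn))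
      rw [hR] at hn ⊢
      rw [← h.rel R _ hn, Formula.Realize, BoundedFormula.realize_rel, hargs]
  | imp _ _ ih₁ ih₂ =>
    rw [formulaCode_imp] at hn ⊢
    rw [hb.imp _ _ hn, ← ih₁ ((left_lt_impCode _ _).trans hn),
      ← ih₂ ((right_lt_impCode _ _).trans hn), Formula.realize_imp]

theorem funMap_eq_of_funcCode_eq {k : ℕ} {f : L.Functions k} {g : L.Functions m}
    {ts : Fin k → ℕ} {us : Fin m → ℕ}
    (h : funcCode (c.func ⟨k, f⟩) (List.ofFn ts) = funcCode (c.func ⟨m, g⟩) (List.ofFn us))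
    (x : ℕ → M) : funMap f (x ∘ ts) = funMap g (x ∘ us) := by
  obtain ⟨hfg, hargs⟩ := funcCode_inj.1 h
  obtain ⟨rfl, hfg⟩ := Sigma.mk.inj_iff.1 (c.func.injective hfg)
  rw [eq_of_heq hfg, List.ofFn_injective hargs]

theorem relMap_iff_of_relCode_eq {k : ℕ} {R : L.Relations k} {S : L.Relations m}
    {ts : Fin k → ℕ} {us : Fin m → ℕ}
    (h : relCode (c.pred ⟨k, R⟩) (List.ofFn ts) = relCode (c.pred ⟨m, S⟩) (List.ofFn us))
    (x : ℕ → M) : RelMap R (x ∘ ts) ↔ RelMap S (x ∘ us) := by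
  obtain ⟨hRS, hargs⟩ := relCode_inj.1 h
  obtain ⟨rfl, hRS⟩ := Sigma.mk.inj_iff.1 (c.pred.injective hRS)
  rw [eq_of_heq hRS, List.ofFn_injective hargs]

theorem exists_eq_funcCode_iff {q : ℕ} :
    (∃ (m : ℕ) (f : L.Functions m) (ts : Fin m → ℕ),
      q = funcCode (c.func ⟨m, f⟩) (List.ofFn ts)) ↔
    codeTag q = 1 ∧ c.IsFunc (codeFst q) (codeArgs q).length := by
  constructor
  · rintro ⟨m, f, ts, rfl⟩
    rw [codeTag_funcCode, codeFst_funcCode, codeArgs_funcCode, List.length_ofFn]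
    exact ⟨rfl, f, rfl⟩
  · rintro ⟨hq, f, hf⟩
    exact ⟨_, f, (codeArgs q).get, by rw [hf, List.ofFn_get, funcCode_eta hq]⟩

theorem exists_eq_relCode_iff {q : ℕ} :
    (∃ (m : ℕ) (R : L.Relations m) (ts : Fin m → ℕ),
      q = relCode (c.pred ⟨m, R⟩) (List.ofFn ts)) ↔
    codeTag q = 2 ∧ c.IsPred (codeFst q) (codeArgs q).length := by
  constructor
  · rintro ⟨m, R, ts, rfl⟩
    rw [codeTag_relCode, codeFst_relCode, codeArgs_relCode, List.length_ofFn]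
    exact ⟨rfl, R, rfl⟩
  · rintro ⟨hq, R, hR⟩
    exact ⟨_, R, (codeArgs q).get, by rw [hR, List.ofFn_get, relCode_eta hq]⟩

open Classical in
/-- The value of the code `q` as a term, for the values `v` of the variables. Codes that are not
function applications are treated as variables. -/
noncomputable def codeValue (c : Numbering L) (v : ℕ → M) (q : ℕ) : M :=
  if h : codeTag q = 1 ∧ c.IsFunc (codeFst q) (codeArgs q).length then
    funMap h.2.choose fun i => codeValue c v ((codeArgs q).get i)
  else v (q.unpair.2 / 2)
termination_by q
decreasing_by exact lt_of_mem_codeArgs h.1 (List.get_mem _ _)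

theorem codeValue_varCode (c : Numbering L) (v : ℕ → M) (a : ℕ) :
    codeValue c v (varCode a) = v a := by
  rw [codeValue, dif_neg (by simp)]
  simp [varCode]

theorem codeValue_funcCode (v : ℕ → M) (f : L.Functions m) (ts : Fin m → ℕ) :
    codeValue c v (funcCode (c.func ⟨m, f⟩) (List.ofFn ts)) = funMap f (codeValue c v ∘ ts) := by
  have h := (exists_eq_funcCode_iff (c := c)).1 ⟨m, f, ts, rfl⟩
  rw [codeValue, dif_pos h]
  refine funMap_eq_of_funcCode_eq (c := c) (ts := (codeArgs _).get) ?_ (codeValue c v)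
  rw [h.2.choose_spec, List.ofFn_get, funcCode_eta h.1]

/-- The truth value of the code `q` as a formula, for the values `x` of the codes of terms. Codes
with tag `1` are read as equations. -/
def codeTruth (c : Numbering L) (x : ℕ → M) (q : ℕ) : Prop :=
  (codeTag q = 1 ∧ x (codeFst q) = x (codeSnd q)) ∨
  (∃ (m : ℕ) (R : L.Relations m) (ts : Fin m → ℕ),
    q = relCode (c.pred ⟨m, R⟩) (List.ofFn ts) ∧ RelMap R (x ∘ ts)) ∨
  ∃ _ : codeTag q = 3, codeTruth c x (codeFst q) → codeTruth c x (codeSnd q)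
termination_by q
decreasing_by
  · exact codeFst_lt ‹_›
  · exact codeSnd_lt ‹_›

theorem codeTruth_eqCode (s t : ℕ) : codeTruth c x (eqCode s t) ↔ x s = x t := by
  have hrel (k : ℕ) (R : L.Relations k) (ts : Fin k → ℕ) :
      eqCode s t ≠ relCode (c.pred ⟨k, R⟩) (List.ofFn ts) := fun h => by
    simpa using congrArg codeTag h
  rw [codeTruth]
  simp [hrel]

theorem codeTruth_relCode (R : L.Relations m) (ts : Fin m → ℕ) :
    codeTruth c x (relCode (c.pred ⟨m, R⟩) (List.ofFn ts)) ↔ RelMap R (x ∘ ts) := by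
  rw [codeTruth]
  simp only [codeTag_relCode, OfNat.ofNat_ne_one, false_and, Nat.reduceEqDiff,
    IsEmpty.exists_iff, or_false, false_or]
  exact ⟨fun ⟨_, _, _, h, hS⟩ => (relMap_iff_of_relCode_eq h x).2 hS, fun h => ⟨m, R, ts, rfl, h⟩⟩

theorem not_codeTruth_botCode : ¬codeTruth c x botCode := by
  have hrel (k : ℕ) (R : L.Relations k) (ts : Fin k → ℕ) :
      botCode ≠ relCode (c.pred ⟨k, R⟩) (List.ofFn ts) := fun h => by
    simpa using congrArg codeTag h
  rw [codeTruth]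
  simp [hrel]

theorem codeTruth_impCode (s t : ℕ) :
    codeTruth c x (impCode s t) ↔ (codeTruth c x s → codeTruth c x t) := by
  have hrel (k : ℕ) (R : L.Relations k) (ts : Fin k → ℕ) :
      impCode s t ≠ relCode (c.pred ⟨k, R⟩) (List.ofFn ts) := fun h => by
    simpa using congrArg codeTag h
  rw [codeTruth]
  simp [hrel]

theorem evaluates_codeTruth (c : Numbering L) (v : ℕ → M) (n : ℕ) :
    Evaluates c (codeTruth c (codeValue c v)) n M (codeValue c v) :=
  ⟨fun f ts _ => codeValue_funcCode v f ts, fun R ts _ => (codeTruth_relCode R ts).symm,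
    fun s t _ => (codeTruth_eqCode s t).symm⟩

theorem respectsConnectives_codeTruth (c : Numbering L) (x : ℕ → M) (n : ℕ) :
    RespectsConnectives (codeTruth c x) n :=
  ⟨fun _ => not_codeTruth_botCode, fun s t _ => codeTruth_impCode s t⟩

end Evaluation

section Diagram

variable {L : FirstOrder.Language.{u, v}}

/-- The truth values that the binary digits of `g` assign to the codes. -/
def bitTruth (g q : ℕ) : Prop := g.testBit q = true

/-- The code of the literal which gives the truth value `b` to the atomic formula with code `a`. -/
def literalCode (b : Bool) (a : ℕ) : ℕ := if b = true then a else notCode a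

open Classical in
/-- The code of the equation which says that the value of the function application with code `q` is
computed from the values of its arguments; a tautology if `q` is not such a code. Here and in the
other parts of a diagram, the variable `x_s` stands for the value of the code `s`. -/
noncomputable def funcEquation (c : Numbering L) (q : ℕ) : ℕ :=
  if codeTag q = 1 ∧ c.IsFunc (codeFst q) (codeArgs q).length then
    eqCode (varCode q) (funcCode (codeFst q) ((codeArgs q).map varCode))
  else notCode botCode

/-- The code of the literal which gives the truth value `b` to the equation with code `q`; a
tautology if `q` is not such a code. -/
def eqLiteral (b : Bool) (q : ℕ) : ℕ :=
  if codeTag q = 1 then literalCode b (eqCode (varCode (codeFst q)) (varCode (codeSnd q)))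
  else notCode botCode

open Classical in
/-- The code of the literal which gives the truth value `b` to the relational atom with code `q`; a
tautology if `q` is not such a code. -/
noncomputable def relLiteral (c : Numbering L) (b : Bool) (q : ℕ) : ℕ :=
  if codeTag q = 2 ∧ c.IsPred (codeFst q) (codeArgs q).length then
    literalCode b (relCode (codeFst q) ((codeArgs q).map varCode))
  else notCode botCode

/-- The code of a formula which says that the codes below `n` are evaluated correctly, with the
truth values given by the binary digits of `g`. -/
noncomputable def diagram (c : Numbering L) (g n : ℕ) : ℕ :=
  conjCode (fun q => andCode (funcEquation c q)
    (andCode (relLiteral c (g.testBit q) q) (eqLiteral (g.testBit q) q))) n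

variable {c : Numbering L}

theorem Represents.literalCode {C : InterpretationProperty L} {a : ℕ} (ha : Represents c a C)
    (b : Bool) : Represents c (literalCode b a) fun M _ x => (C M x ↔ b = true) := by
  cases b
  · exact ha.not.congr fun _ _ _ => by simp
  · exact ha.congr fun _ _ _ => by simp

theorem represents_funcEquation (c : Numbering L) (q : ℕ) :
    Represents c (funcEquation c q) fun _ _ x => ∀ (m : ℕ) (f : L.Functions m) (ts : Fin m → ℕ),
      q = funcCode (c.func ⟨m, f⟩) (List.ofFn ts) → x q = funMap f (x ∘ ts) := by
  rw [funcEquation]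
  split_ifs with h
  · obtain ⟨m, f, ts, rfl⟩ := exists_eq_funcCode_iff.2 h
    rw [codeFst_funcCode, codeArgs_funcCode]
    exact (Represents.var_eq_func _ f ts).congr fun M _ x =>
      ⟨fun hx _ _ _ hq => hx.trans (funMap_eq_of_funcCode_eq hq x), fun hx => hx m f ts rfl⟩
  · exact Represents.top.congr fun M _ x => iff_of_true trivial fun m f ts hq =>
      (h (exists_eq_funcCode_iff.1 ⟨m, f, ts, hq⟩)).elim

theorem represents_relLiteral (c : Numbering L) (b : Bool) (q : ℕ) :
    Represents c (relLiteral c b q) fun _ _ x => ∀ (m : ℕ) (R : L.Relations m) (ts : Fin m → ℕ),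
      q = relCode (c.pred ⟨m, R⟩) (List.ofFn ts) → (RelMap R (x ∘ ts) ↔ b = true) := by
  rw [relLiteral]
  split_ifs with h
  · obtain ⟨m, R, ts, rfl⟩ := exists_eq_relCode_iff.2 h
    rw [codeFst_relCode, codeArgs_relCode]
    exact ((Represents.rel R ts).literalCode b).congr fun M _ x =>
      ⟨fun hx _ _ _ hq => (relMap_iff_of_relCode_eq hq x).symm.trans hx, fun hx => hx m R ts rfl⟩
  · exact Represents.top.congr fun M _ x => iff_of_true trivial fun m R ts hq =>
      (h (exists_eq_relCode_iff.1 ⟨m, R, ts, hq⟩)).elim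

theorem represents_eqLiteral (c : Numbering L) (b : Bool) (q : ℕ) :
    Represents c (eqLiteral b q) fun _ _ x =>
      ∀ s t, q = eqCode s t → (x s = x t ↔ b = true) := by
  rw [eqLiteral]
  split_ifs with h
  · refine ((Represents.var_eq_var _ _).literalCode b).congr fun M _ x =>
      ⟨?_, fun hx => hx _ _ (eqCode_eta h).symm⟩
    rintro hx s t rfl
    simpa using hx
  · refine Represents.top.congr fun M _ x => iff_of_true trivial ?_
    rintro s t rfl
    simp at h

theorem represents_diagram (c : Numbering L) (g n : ℕ) :
    Represents c (diagram c g n) fun M _ x => Evaluates c (bitTruth g) n M x :=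
  (Represents.conj fun q _ => (represents_funcEquation c q).and
    ((represents_relLiteral c (g.testBit q) q).and
      (represents_eqLiteral c (g.testBit q) q))).congr fun M _ x =>
        ⟨fun h => ⟨fun f ts hq => (h _ hq).1 _ f ts rfl, fun R ts hq => (h _ hq).2.1 _ R ts rfl,
          fun s t hq => (h _ hq).2.2 s t rfl⟩,
        fun h q hq => ⟨by rintro m f ts rfl; exact h.func f ts hq,
          by rintro m R ts rfl; exact h.rel R ts hq, by rintro s t rfl; exact h.eq s t hq⟩⟩

theorem respectsConnectives_iff {b : ℕ → Prop} {n : ℕ} : RespectsConnectives b n ↔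
    ∀ q < n, (q = botCode → ¬b q) ∧
      (codeTag q = 3 → (b q ↔ (b (codeFst q) → b (codeSnd q)))) := by
  constructor
  · refine fun h q hq => ⟨by rintro rfl; exact h.bot hq, fun htag => ?_⟩
    simpa only [impCode_eta htag] using h.imp (codeFst q) (codeSnd q) (by rwa [impCode_eta htag])
  · exact fun h => ⟨fun hlt => (h _ hlt).1 rfl,
      fun s t hlt => by simpa using (h _ hlt).2 (codeTag_impCode s t)⟩

variable {α : Type*} [Primcodable α] {f g n : α → ℕ}

theorem computablePred_bitTruth (hg : Computable g) (hf : Computable f) :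
    ComputablePred fun a => bitTruth (g a) (f a) :=
  computablePred_testBit hg hf

theorem computable_literalCode {b : α → Bool} (hb : Computable b) (hf : Computable f) :
    Computable fun a => literalCode (b a) (f a) :=
  computable_ite (computablePred_eq hb (Computable.const true)) hf (primrec_notCode.to_comp.comp hf)

theorem computable_map_varCode : Computable (List.map varCode) :=
  (Primrec.list_map Primrec.id (primrec_varCode.comp Primrec.snd).to₂).to_comp

theorem computablePred_codeTag_eq (i : ℕ) : ComputablePred fun q => codeTag q = i :=
  computablePred_eq primrec_codeTag.to_comp (Computable.const i)

theorem computable_codeFst_length_codeArgs :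
    Computable fun q => (codeFst q, (codeArgs q).length) :=
  primrec_codeFst.to_comp.pair (Primrec.list_length.comp primrec_codeArgs).to_comp

theorem computable_funcEquation (hc : c.DecidableArities) : Computable (funcEquation c) := by
  classical
  exact computable_ite
    (computablePred_and (computablePred_codeTag_eq 1)
      (computablePred_comp hc.func computable_codeFst_length_codeArgs))
    (primrec₂_eqCode.to_comp.comp primrec_varCode.to_comp
      (primrec₂_funcCode.to_comp.comp primrec_codeFst.to_comp
        (computable_map_varCode.comp primrec_codeArgs.to_comp)))
    (Computable.const (notCode botCode))

theorem computable₂_relLiteral (hc : c.DecidableArities) : Computable₂ (relLiteral c) := by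
  classical
  exact computable_ite (p := fun x : Bool × ℕ => _)
    (computablePred_comp (computablePred_and (computablePred_codeTag_eq 2)
      (computablePred_comp hc.pred computable_codeFst_length_codeArgs)) Computable.snd)
    (computable_literalCode Computable.fst
      ((primrec₂_relCode.to_comp.comp primrec_codeFst.to_comp
        (computable_map_varCode.comp primrec_codeArgs.to_comp)).comp Computable.snd))
    (Computable.const (notCode botCode))

theorem computable₂_eqLiteral : Computable₂ eqLiteral :=
  computable_ite (p := fun x : Bool × ℕ => codeTag x.2 = 1)
    (computablePred_comp (computablePred_codeTag_eq 1) Computable.snd)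
    (computable_literalCode Computable.fst
      ((primrec₂_eqCode.comp (primrec_varCode.comp primrec_codeFst)
        (primrec_varCode.comp primrec_codeSnd)).to_comp.comp Computable.snd))
    (Computable.const (notCode botCode))

theorem computable_diagram (hc : c.DecidableArities) (hg : Computable g) (hn : Computable n) :
    Computable fun a => diagram c (g a) (n a) := by
  classical
  have hbit : Computable fun x : α × ℕ => (g x.1).testBit x.2 :=
    (computablePred_testBit (hg.comp Computable.fst) Computable.snd).decide.of_eq fun x => by simp
  exact computable_conjCode (a := fun a q => andCode (funcEquation c q)
      (andCode (relLiteral c ((g a).testBit q) q) (eqLiteral ((g a).testBit q) q)))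
    (primrec₂_andCode.to_comp.comp ((computable_funcEquation hc).comp Computable.snd)
      (primrec₂_andCode.to_comp.comp ((computable₂_relLiteral hc).comp hbit Computable.snd)
        (computable₂_eqLiteral.comp hbit Computable.snd))).to₂ hn

theorem computablePred_respectsConnectives (hg : Computable g) (hn : Computable n) :
    ComputablePred fun a => RespectsConnectives (bitTruth (g a)) (n a) := by
  have hbit {f : ℕ → ℕ} (hf : Computable f) :
      ComputablePred fun x : α × ℕ => bitTruth (g x.1) (f x.2) :=
    computablePred_bitTruth (hg.comp Computable.fst) (hf.comp Computable.snd)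
  have himp : ComputablePred fun x : α × ℕ => codeTag x.2 = 3 → (bitTruth (g x.1) x.2 ↔
      (bitTruth (g x.1) (codeFst x.2) → bitTruth (g x.1) (codeSnd x.2))) :=
    computablePred_imp (computablePred_comp (computablePred_codeTag_eq 3) Computable.snd)
      (computablePred_iff (hbit Computable.id)
        (computablePred_imp (hbit primrec_codeFst.to_comp) (hbit primrec_codeSnd.to_comp)))
  have hbot : ComputablePred fun x : α × ℕ => x.2 = botCode → ¬bitTruth (g x.1) x.2 :=
    computablePred_imp (computablePred_eq Computable.snd (Computable.const botCode))
      (hbit Computable.id).not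
  exact (computablePred_forall_lt hn (computablePred_and hbot himp)).of_eq fun a =>
    respectsConnectives_iff.symm

end Diagram

section Cardinalities

variable {L : FirstOrder.Language.{u, v}} {c : Numbering L} {T : L.Theory} {φ : L.Formula ℕ}

/-- `φ` is satisfied by an interpretation of `T` of cardinality at least `κ`, where `⊤` stands for
`ℵ₀`. -/
def IsSatAbove (T : L.Theory) (κ : ℕ∞) (φ : L.Formula ℕ) : Prop :=
  ∃ (M : Type) (_ : L.Structure M) (x : ℕ → M), M ⊨ T ∧ φ.Realize x ∧ (κ : Cardinal.{0}) ≤ #M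

/-- The value of a minimal model function that an output of a machine stands for. -/
def outputCard (o : Option ℕ) : ℕ∞ := o.elim ⊤ fun k : ℕ => (k : ℕ∞)

/-- The code of a formula which says that the variables with the indices `k, …, k + m - 1` have
distinct values. -/
def distinctCode (k m : ℕ) : ℕ :=
  conjCode (fun i => conjCode (fun j => notCode (eqCode (varCode (k + i)) (varCode (k + j)))) i) m

theorem le_varCode (a : ℕ) : a ≤ varCode a :=
  (Nat.le_mul_of_pos_left a two_pos).trans (Nat.right_le_pair _ _)

theorem realize_term_congr_of_le_termCode (c : Numbering L) {M : Type*} [L.Structure M]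
    {x y : ℕ → M} (z : Fin 0 → M) (t : L.Term (ℕ ⊕ Fin 0))
    (hxy : ∀ i ≤ termCode c t, x i = y i) :
    t.realize (Sum.elim x z) = t.realize (Sum.elim y z) := by
  induction t with
  | var a =>
    rcases a with a | a
    · exact hxy a ((le_varCode a).trans_eq (termCode_var_inl c a).symm)
    · exact a.elim0
  | func f ts ih =>
    rw [Term.realize_func, Term.realize_func]
    congr 1
    funext i
    have hlt : termCode c (ts i) < termCode c (Term.func f ts) := by
      rw [termCode_func]
      exact lt_funcCode_of_mem (List.mem_ofFn.2 ⟨i, rfl⟩)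
    exact ih i fun j hj => hxy j (hj.trans hlt.le)

theorem realize_congr_of_lt_formulaCode (c : Numbering L) {M : Type*} [L.Structure M]
    {x y : ℕ → M} (hφ : φ.IsQF) (hxy : ∀ i < formulaCode c φ, x i = y i) :
    φ.Realize x ↔ φ.Realize y := by
  have hterm {k : ℕ} (t : L.Term (ℕ ⊕ Fin 0)) (ht : termCode c t < k)
      (hk : ∀ i < k, x i = y i) :
      t.realize (Sum.elim x default) = t.realize (Sum.elim y default) :=
    realize_term_congr_of_le_termCode c _ t fun i hi => hk i (hi.trans_lt ht)
  induction hφ with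
  | falsum => exact Iff.rfl
  | of_isAtomic hφ =>
    cases hφ with
    | equal s t =>
      rw [Formula.Realize, Formula.Realize, BoundedFormula.realize_bdEqual,
        BoundedFormula.realize_bdEqual, hterm s (left_lt_eqCode _ _) hxy,
        hterm t (right_lt_eqCode _ _) hxy]
    | rel R ts =>
      have hargs : (fun i => (ts i).realize (Sum.elim x default)) =
          fun i => (ts i).realize (Sum.elim y default) :=
        funext fun i => hterm (ts i) (lt_relCode_of_mem (List.mem_ofFn.2 ⟨i, rfl⟩)) hxy
      rw [Formula.Realize, Formula.Realize, BoundedFormula.realize_rel,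
        BoundedFormula.realize_rel, hargs]
  | imp _ _ ih₁ ih₂ =>
    rw [Formula.realize_imp, Formula.realize_imp]
    exact imp_congr (ih₁ fun i hi => hxy i (hi.trans (left_lt_impCode _ _)))
      (ih₂ fun i hi => hxy i (hi.trans (right_lt_impCode _ _)))

theorem represents_distinctCode (c : Numbering L) (k m : ℕ) :
    Represents c (distinctCode k m) fun _ _ x => Function.Injective fun i : Fin m => x (k + i) := by
  refine (Represents.conj fun i _ => .conj fun j _ =>
    (Represents.var_eq_var (k + i) (k + j)).not).congr fun M _ x => ⟨fun h i j hij => ?_,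
      fun h i hi j hj hij => hj.ne' ?_⟩
  · by_contra hne
    rcases lt_or_gt_of_ne hne with hlt | hlt
    · exact h j j.2 i hlt hij.symm
    · exact h i i.2 j hlt hij
  · exact congrArg Fin.val (@h ⟨i, hi⟩ ⟨j, hj.trans hi⟩ hij)

theorem computable₂_distinctCode : Computable₂ distinctCode := by
  have hvar {α : Type} [Primcodable α] {k i : α → ℕ} (hk : Computable k) (hi : Computable i) :
      Computable fun a => varCode (k a + i a) :=
    primrec_varCode.to_comp.comp (Primrec.nat_add.to_comp.comp hk hi)
  have hk : Computable fun z : ((ℕ × ℕ) × ℕ) × ℕ => z.1.1.1 :=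
    Computable.fst.comp (Computable.fst.comp Computable.fst)
  exact computable_conjCode (a := fun x : ℕ × ℕ => fun i =>
      conjCode (fun j => notCode (eqCode (varCode (x.1 + i)) (varCode (x.1 + j)))) i)
    (computable_conjCode (a := fun y : (ℕ × ℕ) × ℕ => fun j =>
        notCode (eqCode (varCode (y.1.1 + y.2)) (varCode (y.1.1 + j))))
      (primrec_notCode.to_comp.comp (primrec₂_eqCode.to_comp.comp
        (hvar hk (Computable.snd.comp Computable.fst)) (hvar hk Computable.snd))).to₂
      Computable.snd).to₂ Computable.snd

theorem exists_injective_of_natCast_le_mk {M : Type u} (x : ℕ → M) (k : ℕ) {m : ℕ}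
    (h : (m : Cardinal) ≤ #M) :
    ∃ y : ℕ → M, (∀ i < k, x i = y i) ∧ Function.Injective fun i : Fin m => y (k + i) := by
  rw [← Cardinal.lift_natCast.{u, 0}, ← Cardinal.mk_fin, ← Cardinal.lift_uzero #M,
    Cardinal.lift_mk_le'] at h
  obtain ⟨e⟩ := h
  refine ⟨fun i => if h : k ≤ i ∧ i - k < m then e ⟨i - k, h.2⟩ else x i, fun i hi => ?_,
    fun i j hij => e.injective ?_⟩
  · dsimp only
    rw [dif_neg (by omega)]
  · simpa using hij

theorem isSatAbove_top : IsSatAbove T ⊤ φ ↔ IsInfinitelySat T φ := by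
  simp only [IsSatAbove, IsInfinitelySat, Cardinal.ofENat_top, Cardinal.infinite_iff]
  exact exists₃_congr fun _ _ _ => by tauto

theorem isSatAbove_natCast (c : Numbering L) (hφ : φ.IsQF) (m : ℕ) : IsSatAbove T m φ ↔
    HasCode c (IsSat T) (andCode (formulaCode c φ) (distinctCode (formulaCode c φ) m)) := by
  have hφcode : Represents c (formulaCode c φ) fun _ _ x => φ.Realize x :=
    ⟨φ, hφ, rfl, fun _ _ _ => Iff.rfl⟩
  rw [(hφcode.and (represents_distinctCode c _ m)).hasCode_isSat]
  constructor
  · rintro ⟨M, _, x, hM, hx, hm⟩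
    obtain ⟨y, hxy, hy⟩ := exists_injective_of_natCast_le_mk x (formulaCode c φ) hm
    exact ⟨M, _, y, hM, (realize_congr_of_lt_formulaCode c hφ hxy).1 hx, hy⟩
  · rintro ⟨M, _, x, hM, hx, hinj⟩
    exact ⟨M, _, x, hM, hx, by simpa using Cardinal.mk_le_of_injective hinj⟩

theorem hasCode_isSatAbove_outputCard_iff (k : ℕ) (o : Option ℕ) :
    HasCode c (IsSatAbove T (outputCard o)) k ↔
      (o = none ∧ HasCode c (IsInfinitelySat T) k) ∨
        (o ≠ none ∧ HasCode c (IsSat T) (andCode k (distinctCode k (o.getD 0)))) := by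
  cases o with
  | none => simp [outputCard, HasCode, isSatAbove_top]
  | some m =>
    simp only [outputCard, Option.elim_some, reduceCtorEq, false_and, ne_eq, not_false_eq_true,
      true_and, false_or, Option.getD_some]
    constructor
    · rintro ⟨φ, hφ, rfl, h⟩
      exact (isSatAbove_natCast c hφ m).1 h
    · intro h
      have himp := ((isQFCode_impCode c).1 h.isQFCode).1
      obtain ⟨φ, hφ, rfl, -⟩ := ((isQFCode_impCode c).1 himp).1
      exact ⟨φ, hφ, rfl, (isSatAbove_natCast c hφ m).2 h⟩

theorem computablePred_hasCode_isSatAbove {α : Type*} [Primcodable α]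
    (hdec : DecidableTheory c T) (hinf : InfinitelyDecidable c T) {o : α → Option ℕ} {f : α → ℕ}
    (ho : Computable o) (hf : Computable f) :
    ComputablePred fun a => HasCode c (IsSatAbove T (outputCard (o a))) (f a) := by
  have hnone : ComputablePred fun a => o a = none := computablePred_eq ho (Computable.const none)
  have hand : Computable fun a => andCode (f a) (distinctCode (f a) ((o a).getD 0)) :=
    primrec₂_andCode.to_comp.comp hf (computable₂_distinctCode.comp hf
      (Computable.option_getD ho (Computable.const 0)))
  exact (computablePred_or
    (computablePred_and hnone (computablePred_comp (p := HasCode c (IsInfinitelySat T)) hinf hf))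
    (computablePred_and hnone.not (computablePred_comp (p := HasCode c (IsSat T)) hdec
      hand))).of_eq fun a => (hasCode_isSatAbove_outputCard_iff (f a) (o a)).symm

theorem ComputableOnQF.exists_computable {f : L.Formula ℕ → ℕ∞} (hf : ComputableOnQF c f)
    {S : L.Formula ℕ → Prop} (hS : DecidableSet c S) :
    ∃ h : ℕ → Option ℕ, Computable h ∧
      ∀ φ : L.Formula ℕ, φ.IsQF → S φ → f φ = outputCard (h (formulaCode c φ)) := by
  classical
  replace hS : ComputablePred (HasCode c S) := hS
  obtain ⟨g, hg, hgf⟩ := hf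
  have hp := Partrec.cond hS.decide hg (Computable.const (none : Option ℕ)).partrec
  have hdom (k : ℕ) :
      (cond (decide (HasCode c S k)) (g k) (Part.some (none : Option ℕ))).Dom := by
    by_cases hk : HasCode c S k
    · obtain ⟨φ, hφ, rfl, -⟩ := id hk
      obtain ⟨o, ho, -⟩ := hgf φ hφ
      simpa [hk] using ho.fst
    · simp [hk]
  refine ⟨fun k => Part.get _ (hdom k), hp.of_eq_tot fun k => Part.get_mem _, fun φ hφ hSφ => ?_⟩
  obtain ⟨o, ho, hfφ⟩ := hgf φ hφ
  have hk := (hasCode_formulaCode c hφ).2 hSφ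
  simp only [hk, decide_true, cond_true]
  rw [hfφ, Part.get_eq_of_mem ho, outputCard]

end Cardinalities

section Combination

variable {L₁ : FirstOrder.Language.{u₁, v₁}} {L₂ : FirstOrder.Language.{u₂, v₂}}
  {c : Numbering (L₁.sum L₂)} {T₁ : L₁.Theory} {T₂ : L₂.Theory}

/-- Models of `T₁` and `T₂` of the same cardinality satisfy `C₁` and `C₂`, respectively. -/
def SatInEqualCard (T₁ : L₁.Theory) (T₂ : L₂.Theory) (C₁ : InterpretationProperty L₁)
    (C₂ : InterpretationProperty L₂) : Prop :=
  ∃ (M N : Type) (_ : L₁.Structure M) (_ : L₂.Structure N) (x : ℕ → M) (y : ℕ → N),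
    #M = #N ∧ M ⊨ T₁ ∧ C₁ M x ∧ N ⊨ T₂ ∧ C₂ N y

theorem Smooth.exists_model_mk_eq (hsmooth : Smooth T₁) {minmod : L₁.Formula ℕ → ℕ∞}
    (hmin : IsMinimalModelFunction T₁ minmod) {φ : L₁.Formula ℕ} (hφ : φ.IsQF)
    (hsat : IsSat T₁ φ) {κ : Cardinal.{0}} (hκ : (minmod φ : Cardinal.{0}) ≤ κ) :
    ∃ (M : Type) (_ : L₁.Structure M) (x : ℕ → M), M ⊨ T₁ ∧ φ.Realize x ∧ #M = κ := by
  obtain ⟨M, _, x, hM, hx, hcard⟩ := (hmin φ hφ hsat).1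
  rcases hκ.eq_or_lt with heq | hlt
  · exact ⟨M, _, x, hM, hx, hcard.trans heq⟩
  · exact hsmooth φ hφ M x hM hx κ (hcard ▸ hlt)

theorem satInEqualCard_iff {c₁ : Numbering L₁} {c₂ : Numbering L₂} (hsmooth : Smooth T₁)
    {minmod : L₁.Formula ℕ → ℕ∞} (hmin : IsMinimalModelFunction T₁ minmod) {κ : ℕ → ℕ∞}
    (hκ : ∀ φ : L₁.Formula ℕ, φ.IsQF → IsSat T₁ φ → minmod φ = κ (formulaCode c₁ φ))
    {a₁ a₂ : ℕ} {C₁ : InterpretationProperty L₁} {C₂ : InterpretationProperty L₂}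
    (h₁ : Represents c₁ a₁ C₁) (h₂ : Represents c₂ a₂ C₂) :
    SatInEqualCard T₁ T₂ C₁ C₂ ↔
      HasCode c₁ (IsSat T₁) a₁ ∧ HasCode c₂ (IsSatAbove T₂ (κ a₁)) a₂ := by
  obtain ⟨φ₁, hφ₁, rfl, hC₁⟩ := h₁
  obtain ⟨φ₂, hφ₂, rfl, hC₂⟩ := h₂
  rw [hasCode_formulaCode c₁ hφ₁, hasCode_formulaCode c₂ hφ₂]
  simp only [SatInEqualCard, ← hC₁, ← hC₂]
  constructor
  · rintro ⟨M, N, _, _, x, y, hMN, hM, hx, hN, hy⟩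
    have hsat : IsSat T₁ φ₁ := ⟨M, _, x, hM, hx⟩
    refine ⟨hsat, N, _, y, hN, hy, ?_⟩
    rw [← hκ φ₁ hφ₁ hsat, ← hMN]
    exact (hmin φ₁ hφ₁ hsat).2 M x hM hx
  · rintro ⟨hsat, N, _, y, hN, hy, hle⟩
    rw [← hκ φ₁ hφ₁ hsat] at hle
    obtain ⟨M, _, x, hM, hx, hMN⟩ := hsmooth.exists_model_mk_eq hmin hφ₁ hsat hle
    exact ⟨M, N, _, _, x, y, hMN, hM, hx, hN, hy⟩

section Expansion

variable {M : Type} [L₁.Structure M] [L₂.Structure M] [(L₁.sum L₂).Structure M]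
  [(LHom.sumInl : L₁ →ᴸ L₁.sum L₂).IsExpansionOn M]
  [(LHom.sumInr : L₂ →ᴸ L₁.sum L₂).IsExpansionOn M]

theorem model_combine_iff : M ⊨ combine T₁ T₂ ↔ M ⊨ T₁ ∧ M ⊨ T₂ := by
  rw [combine, Theory.model_union_iff, LHom.onTheory_model, LHom.onTheory_model]

theorem evaluates_sum_iff {b : ℕ → Prop} {n : ℕ} {x : ℕ → M} :
    Evaluates c b n M x ↔ Evaluates c.left b n M x ∧ Evaluates c.right b n M x := by
  have hinl {m : ℕ} (R : L₁.Relations m) (z : Fin m → M) :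
      RelMap (L := L₁.sum L₂) (Sum.inl R) z ↔ RelMap R z :=
    Iff.of_eq (LHom.map_onRelation LHom.sumInl R z)
  have hinr {m : ℕ} (R : L₂.Relations m) (z : Fin m → M) :
      RelMap (L := L₁.sum L₂) (Sum.inr R) z ↔ RelMap R z :=
    Iff.of_eq (LHom.map_onRelation LHom.sumInr R z)
  constructor
  · refine fun h => ⟨⟨fun f ts hn => ?_, fun R ts hn => ?_, h.eq⟩,
      ⟨fun f ts hn => ?_, fun R ts hn => ?_, h.eq⟩⟩
    · exact (h.func (Sum.inl f) ts hn).trans (LHom.map_onFunction LHom.sumInl f _)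
    · exact (hinl R _).symm.trans (h.rel (Sum.inl R) ts hn)
    · exact (h.func (Sum.inr f) ts hn).trans (LHom.map_onFunction LHom.sumInr f _)
    · exact (hinr R _).symm.trans (h.rel (Sum.inr R) ts hn)
  · rintro ⟨h₁, h₂⟩
    refine ⟨fun f ts hn => ?_, fun R ts hn => ?_, h₁.eq⟩
    · rcases f with f | f
      · exact (h₁.func f ts hn).trans (LHom.map_onFunction LHom.sumInl f _).symm
      · exact (h₂.func f ts hn).trans (LHom.map_onFunction LHom.sumInr f _).symm
    · rcases R with R | R
      · exact (hinl R _).trans (h₁.rel R ts hn)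
      · exact (hinr R _).trans (h₂.rel R ts hn)

end Expansion

/-- A bound above the codes of all equations between codes up to `k`. -/
def codeBound (k : ℕ) : ℕ := eqCode k k + 1

theorem eqCode_lt_codeBound {s t k : ℕ} (hs : s ≤ k) (ht : t ≤ k) : eqCode s t < codeBound k :=
  Nat.lt_succ_of_le (eqCode_le_eqCode hs ht)

theorem lt_codeBound (k : ℕ) : k < codeBound k :=
  (left_lt_eqCode k k).trans (eqCode_lt_codeBound le_rfl le_rfl)

theorem computable_codeBound : Computable codeBound :=
  Computable.succ.comp (primrec₂_eqCode.to_comp.comp Computable.id Computable.id)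

theorem exists_bitTruth_of_isSat_combine {φ : (L₁.sum L₂).Formula ℕ} (hφ : φ.IsQF)
    (h : IsSat (combine T₁ T₂) φ) {n : ℕ} (hn : formulaCode c φ < n) :
    ∃ g < 2 ^ n, RespectsConnectives (bitTruth g) n ∧ bitTruth g (formulaCode c φ) ∧
      SatInEqualCard T₁ T₂ (fun M _ x => Evaluates c.left (bitTruth g) n M x)
        fun N _ y => Evaluates c.right (bitTruth g) n N y := by
  obtain ⟨M, _, v, hM, hv⟩ := h
  let := (LHom.sumInl : L₁ →ᴸ L₁.sum L₂).reduct M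
  let := (LHom.sumInr : L₂ →ᴸ L₁.sum L₂).reduct M
  obtain ⟨hM₁, hM₂⟩ := model_combine_iff.1 hM
  have heval := evaluates_codeTruth c v n
  have hconn := respectsConnectives_codeTruth c (codeValue c v) n
  have htrue : codeTruth c (codeValue c v) (formulaCode c φ) := by
    rw [← heval.realize_formula hconn hφ hn]
    simpa only [codeValue_varCode] using hv
  obtain ⟨g, hg, hbits⟩ := exists_testBit_iff (codeTruth c (codeValue c v)) n
  have hbits' (i : ℕ) (hi : i < n) := (hbits i hi).symm
  obtain ⟨h₁, h₂⟩ := evaluates_sum_iff.1 (heval.congr (fun _ _ => rfl) hbits')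
  exact ⟨g, hg, hconn.congr hbits', (hbits _ hn).2 htrue, M, M, _, _, _, _, rfl, hM₁, h₁, hM₂, h₂⟩

theorem isSat_combine_of_satInEqualCard {φ : (L₁.sum L₂).Formula ℕ} (hφ : φ.IsQF)
    {b : ℕ → Prop} {n : ℕ} (hn : codeBound (formulaCode c φ) ≤ n) (hb : RespectsConnectives b n)
    (hφb : b (formulaCode c φ))
    (h : SatInEqualCard T₁ T₂ (fun M _ x => Evaluates c.left b n M x)
      fun N _ y => Evaluates c.right b n N y) : IsSat (combine T₁ T₂) φ := by
  obtain ⟨M, N, _, _, x, y, hMN, hM, hx, hN, hy⟩ := h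
  have hφn : formulaCode c φ + 1 ≤ n := (lt_codeBound _).trans_le hn
  obtain ⟨e, he⟩ : ∃ e : M ≃ N, ∀ i < formulaCode c φ + 1, e (x i) = y i := by
    refine exists_equiv_extending hMN x y (Set.finite_Iio _) fun i hi j hj => ?_
    have hij := (eqCode_lt_codeBound (Nat.le_of_lt_succ hi) (Nat.le_of_lt_succ hj)).trans_le hn
    rw [hx.eq i j hij, hy.eq i j hij]
  let : L₁.Structure N := e.inducedStructure
  have hN₁ : N ⊨ T₁ := StrongHomClass.theory_model (e.inducedStructureEquiv (L := L₁))
  have hy₁ := ((hx.induced e).mono hφn).congr he fun _ _ => Iff.rfl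
  have heval := evaluates_sum_iff.2 ⟨hy₁, hy.mono hφn⟩
  exact ⟨N, inferInstance, fun a => y (varCode a), model_combine_iff.2 ⟨hN₁, hN⟩,
    (heval.realize_formula (hb.mono hφn) hφ (Nat.lt_succ_self _)).2 hφb⟩

/-- The binary digits of `g` are truth values of the codes below `codeBound k` that make the formula
with code `k` true and belong to interpretations of `T₁` and `T₂` of the same cardinality. Here `h`
computes the minimal model function of `T₁`. -/
def IsCertificate (c : Numbering (L₁.sum L₂)) (T₁ : L₁.Theory) (T₂ : L₂.Theory)
    (h : ℕ → Option ℕ) (k g : ℕ) : Prop :=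
  RespectsConnectives (bitTruth g) (codeBound k) ∧ bitTruth g k ∧
    HasCode c.left (IsSat T₁) (diagram c.left g (codeBound k)) ∧
      HasCode c.right (IsSatAbove T₂ (outputCard (h (diagram c.left g (codeBound k)))))
        (diagram c.right g (codeBound k))

theorem hasCode_isSat_combine_iff (hsmooth : Smooth T₁) {minmod : L₁.Formula ℕ → ℕ∞}
    (hmin : IsMinimalModelFunction T₁ minmod) {h : ℕ → Option ℕ}
    (hh : ∀ φ : L₁.Formula ℕ, φ.IsQF → IsSat T₁ φ →
      minmod φ = outputCard (h (formulaCode c.left φ))) (k : ℕ) :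
    HasCode c (IsSat (combine T₁ T₂)) k ↔
      IsQFCode c k ∧ ∃ g < 2 ^ codeBound k, IsCertificate c T₁ T₂ h k g := by
  have hcard (g n : ℕ) := satInEqualCard_iff (T₂ := T₂)
    (κ := fun a => outputCard (h a)) hsmooth hmin hh
    (represents_diagram c.left g n) (represents_diagram c.right g n)
  simp only [IsCertificate, ← hcard]
  constructor
  · rintro ⟨φ, hφ, rfl, hsat⟩
    exact ⟨⟨φ, hφ, rfl, trivial⟩, exists_bitTruth_of_isSat_combine hφ hsat (lt_codeBound _)⟩
  · rintro ⟨⟨φ, hφ, rfl, -⟩, g, -, hconn, hg, hmodels⟩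
    exact ⟨φ, hφ, rfl, isSat_combine_of_satInEqualCard hφ le_rfl hconn hg hmodels⟩

theorem computablePred_isCertificate (hc₁ : c.left.DecidableArities)
    (hc₂ : c.right.DecidableArities) (hdec₁ : DecidableTheory c.left T₁)
    (hdec₂ : DecidableTheory c.right T₂) (hinf : InfinitelyDecidable c.right T₂)
    {h : ℕ → Option ℕ} (hh : Computable h) :
    ComputablePred fun x : ℕ × ℕ => IsCertificate c T₁ T₂ h x.1 x.2 := by
  have hbound : Computable fun x : ℕ × ℕ => codeBound x.1 :=
    computable_codeBound.comp Computable.fst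
  have hdiag₁ : Computable fun x : ℕ × ℕ => diagram c.left x.2 (codeBound x.1) :=
    computable_diagram hc₁ Computable.snd hbound
  have hdiag₂ : Computable fun x : ℕ × ℕ => diagram c.right x.2 (codeBound x.1) :=
    computable_diagram hc₂ Computable.snd hbound
  have hsat : ComputablePred fun x : ℕ × ℕ =>
      HasCode c.left (IsSat T₁) (diagram c.left x.2 (codeBound x.1)) :=
    computablePred_comp (p := HasCode c.left (IsSat T₁)) hdec₁ hdiag₁
  have habove : ComputablePred fun x : ℕ × ℕ => HasCode c.right
      (IsSatAbove T₂ (outputCard (h (diagram c.left x.2 (codeBound x.1)))))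
      (diagram c.right x.2 (codeBound x.1)) :=
    computablePred_hasCode_isSatAbove hdec₂ hinf (hh.comp hdiag₁) hdiag₂
  exact computablePred_and (computablePred_respectsConnectives Computable.snd hbound)
    (computablePred_and (computablePred_bitTruth Computable.snd Computable.fst)
      (computablePred_and hsat habove))

theorem decidableTheory_combine_of_not_isSat_top (h : ¬(IsSat T₁ ⊤ ∧ IsSat T₂ ⊤)) :
    DecidableTheory c (combine T₁ T₂) := by
  refine (computablePred_eq (Computable.const 0) (Computable.const 1)).of_eq fun k =>
    iff_of_false zero_ne_one ?_
  rintro ⟨φ, -, -, M, _, x, hM, -⟩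
  let := (LHom.sumInl : L₁ →ᴸ L₁.sum L₂).reduct M
  let := (LHom.sumInr : L₂ →ᴸ L₁.sum L₂).reduct M
  obtain ⟨hM₁, hM₂⟩ := model_combine_iff.1 hM
  exact h ⟨⟨M, _, x, hM₁, id⟩, M, _, x, hM₂, id⟩

end Combination

end TheoryCombination

theorem mainTheorem11
    (L₁ : FirstOrder.Language.{u₁, v₁}) (L₂ : FirstOrder.Language.{u₂, v₂})
    (c : TheoryCombination.Numbering (L₁.sum L₂))
    (T₁ : L₁.Theory) (T₂ : L₂.Theory)
    (hdec₁ : TheoryCombination.DecidableTheory c.left T₁)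
    (hdec₂ : TheoryCombination.DecidableTheory c.right T₂)
    (hsmooth : TheoryCombination.Smooth T₁)
    (hminmod : TheoryCombination.HasComputableMinimalModelFunction c.left T₁)
    (hinf : TheoryCombination.InfinitelyDecidable c.right T₂) :
    TheoryCombination.DecidableTheory c (TheoryCombination.combine T₁ T₂) := by
  by_cases hsat : TheoryCombination.IsSat T₁ ⊤ ∧ TheoryCombination.IsSat T₂ ⊤
  swap
  · exact TheoryCombination.decidableTheory_combine_of_not_isSat_top hsat
  have hc₁ := hdec₁.decidableArities hsat.1
  have hc₂ := hdec₂.decidableArities hsat.2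
  obtain ⟨minmod, hmin, hcomp⟩ := hminmod
  obtain ⟨h, hh, hminmod_eq⟩ := hcomp.exists_computable hdec₁
  have hbound := TheoryCombination.computable_two_pow.comp TheoryCombination.computable_codeBound
  have hcert := TheoryCombination.computablePred_isCertificate hc₁ hc₂ hdec₁ hdec₂ hinf hh
  exact (TheoryCombination.computablePred_and
    (TheoryCombination.computablePred_isQFCode (hc₁.sum hc₂))
    (TheoryCombination.computablePred_exists_lt hbound hcert)).of_eq fun k =>
      (TheoryCombination.hasCode_isSat_combine_iff hsmooth hmin hminmod_eq k).symm
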